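/- A directed graph here is finite, nonempty, and has no loops and no parallel arcs (antiparallel arcs are allowed); it is $k$-regular if every vertex has out-degree $k$ and in-degree $k$. A cycle cover of $G$ is a set of arcs such that exactly one of them leaves, and exactly one enters, each vertex; its cycles are the connected components of the spanning subgraph it forms. A cycle cover coloring of a $k$-regular directed graph is a map from its arcs to $\{1,\dots,k\}$ such that every color class is a cycle cover. For $k=2^l$ the randomized procedure RandCycleCoverColoring works as follows on a $k$-regular directed graph. If $k=1$, give every arc the color $1$. Otherwise: (i) split every vertex $v$ into two vertices $v_0,v_1$ and distribute the outgoing arcs of $v$ and, independently, the incoming arcs of $v$ uniformly at random among $v_0$ and $v_1$ so that each gets exactly half of the outgoing and half of the incoming arcs (independently for all $v$); (ii) color the resulting $k/2$-regular graph recursively with the colors $1,\dots,k/2$, and fuse the split vertices back; (iii) for each $i\le k/2$ the arcs of color $i$ form a graph $G_i$ with in- and out-degrees $2$; its bipartite encoding (left copy of the tail joined to right copy of the head, for each arc) is a disjoint union of even cycles; for each of these cycles, put its arcs alternately into two sets $S,S'$, choose one of the two sets by an independent fair coin, and recolor it to $i+k/2$. **Theorem.** There are absolute constants $c>0$ and $D$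 such that for every $k$-regular directed graph $G$ on $n$ vertices, with $k$ a power of $2$: 1. every possible output of RandCycleCoverColoring on $G$ is a cycle cover coloring of $G$, that is, a partition of the arcs into $k$ cycle covers; 2. if $k\ge 2$, then with probability at least $1-De^{-cn}$ at least one of these cycle covers has at most $3.5\,n/\ln k$ cycles; 3. the procedure runs in time $O(nk\log k)$ (time $O(n)$ if $k=1$), with an absolute implied constant: there is a single program for a randomized word RAM (words of $O(\log(nk))$ bits, unit cost for arithmetic on words, array access, and drawing a uniformly random integer below a given word) that, given $n$, $k$ and the list of arcs of $G$ in any order, always halts within this time, with an output that has exactly the law of the output of RandCycleCoverColoring on $G$; 4. each fixed cycle cover coloring of $G$ is output with probability at most $\left[\dfrac{k^k}{(k!)^2}\right]^n\dfrac1{2^{k-1}}$; 5. for every $r\ge 0$, the number of cycle covers of $G$ with exactly $r$ cycles is at most $\binom nr k^{n-r}$. -/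

import Mathlib

namespace CycleCovers

/-! ### Directed graphs, cycle covers and cycle cover colorings -/

section Graphs

variable {V : Type*}

/-- The arcs of a directed graph, as ordered pairs (tail, head). -/
abbrev Arc (G : Digraph V) : Type _ := {p : V × V // G.Adj p.1 p.2}

/-- The tail of an arc. -/
def Arc.tail {G : Digraph V} (a : Arc G) : V := a.1.1

/-- The head of an arc. -/
def Arc.head {G : Digraph V} (a : Arc G) : V := a.1.2

/-- Every vertex has out-degree `k` and in-degree `k`. -/
def IsRegular (G : Digraph V) (k : ℕ) : Prop :=
  ∀ v, {w | G.Adj v w}.ncard = k ∧ {u | G.Adj u v}.ncard = k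

/-- A set of arcs is a cycle cover (the arc set of a family of vertex-disjoint directed cycles
through all the vertices) when exactly one of its arcs leaves, and exactly one enters, each
vertex. -/
def IsCycleCover (G : Digraph V) (F : Set (Arc G)) : Prop :=
  ∀ v, (∃! a, a ∈ F ∧ a.tail = v) ∧ (∃! a, a ∈ F ∧ a.head = v)

/-- The number of connected components of the spanning subgraph with arc set `F`.  For a cycle
cover this is the number of its cycles. -/
noncomputable def numComponents (G : Digraph V) (F : Set (Arc G)) : ℕ :=
  Nat.card (SimpleGraph.fromRel fun u v : V =>
    ∃ a ∈ F, a.tail = u ∧ a.head = v).ConnectedComponent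

/-- A cycle cover coloring: the colors are `1, …, k` and each color class is a cycle cover. -/
def IsCycleCoverColoring (G : Digraph V) (k : ℕ) (c : Arc G → ℕ) : Prop :=
  (∀ a, c a ∈ Finset.Icc 1 k) ∧ ∀ i ∈ Finset.Icc 1 k, IsCycleCover G (c ⁻¹' {i})

end Graphs

/-! ### The random procedure

The recursion acts on graphs with a fixed type `A` of arcs; the tail and the head of each arc
are given by two maps to the vertex type, and splitting the vertices changes these two maps only.
Hence "fusing the split vertices back" leaves a coloring `A → ℕ` as it is. -/

section Algorithm

open Classical in
/-- The uniform distribution on a set `S` (the point mass at `default` if `S` is empty; for the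
regular graphs below this does not occur). -/
noncomputable def uniformOn {α : Type*} [Finite α] [Inhabited α] (S : Set α) : PMF α :=
  if h : S.Nonempty then
    PMF.uniformOfFinset S.toFinite.toFinset (S.toFinite.toFinset_nonempty.2 h)
  else PMF.pure default

/-- The ways to distribute the arcs among the two copies `(v, false)` and `(v, true)` of their end
`f a = v` so that at every `v` both copies get the same number of arcs.  A uniformly random
element distributes the arcs at the different vertices independently and uniformly. -/
def balancedSplits {A V : Type*} (f : A → V) : Set (A → Bool) :=
  {s | ∀ v, {a | f a = v ∧ s a = true}.ncard = {a | f a = v ∧ s a = false}.ncard}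

/-- The alternating two-part divisions of all color classes of `c` at once: two different arcs of
the same color with a common tail, or with a common head, lie in different parts.
When each color class is `2`-regular, its arcs fall into closed tours in which consecutive arcs
share alternately a head and a tail (the Euler tours of the connected components of its
bipartite encoding); each tour has exactly two alternating divisions `{S, S'}`, and a uniformly
random element of this set amounts to one independent fair coin for each tour. -/
def alternatingDivisions {A V : Type*} (tail head : A → V) (c : A → ℕ) : Set (A → Bool) :=
  {s | ∀ a b, a ≠ b → c a = c b → (tail a = tail b ∨ head a = head b) → s a ≠ s b}

/-- The law of the coloring output by the procedure on a `2 ^ l`-regular graph.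
For `l = 0` every arc gets color `1`.  Otherwise every vertex is split into two, with a random
balanced distribution of its outgoing and of its incoming arcs; the `2 ^ l`-regular graph
obtained is colored recursively; and in each alternating tour of each color class `i` a random
one of the two alternating parts is recolored to `i + 2 ^ l`. -/
noncomputable def randColoringAux {A : Type*} [Finite A] :
    (l : ℕ) → {V : Type*} → (tail head : A → V) → PMF (A → ℕ)
  | 0, _, _, _ => PMF.pure fun _ => 1
  | l + 1, _, tail, head =>
      (uniformOn (balancedSplits tail)).bind fun s =>
      (uniformOn (balancedSplits head)).bind fun t =>
      (randColoringAux l (fun a => (tail a, s a)) (fun a => (head a, t a))).bind fun c =>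
      (uniformOn (alternatingDivisions tail head c)).bind fun d =>
      PMF.pure fun a => if d a = true then c a + 2 ^ l else c a

/-- The law of the output of the procedure on a `2 ^ l`-regular directed graph `G`. -/
noncomputable def randCycleCoverColoring {V : Type*} [Finite V] (G : Digraph V) (l : ℕ) :
    PMF (Arc G → ℕ) :=
  randColoringAux l Arc.tail Arc.head

end Algorithm

/-! ### A randomized word RAM

Programs are finite texts over finitely many word variables and word arrays (named by natural
numbers).  All numbers are smaller than the word bound `W`; a program that computes a larger
number gets stuck and never halts. -/

section Machine

/-- Arithmetic operations (subtraction is truncated, comparisons give `0` or `1`). -/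
inductive Op
  | add | sub | mul | div | mod | lt | eq

/-- The value of an operation. -/
def Op.apply : Op → ℕ → ℕ → ℕ
  | .add, x, y => x + y
  | .sub, x, y => x - y
  | .mul, x, y => x * y
  | .div, x, y => x / y
  | .mod, x, y => x % y
  | .lt, x, y => if x < y then 1 else 0
  | .eq, x, y => if x = y then 1 else 0

/-- Expressions: constants, variables, array entries `a[i]`, arithmetic. -/
inductive Expr
  | lit (c : ℕ)
  | var (x : ℕ)
  | get (a : ℕ) (i : Expr)
  | bin (o : Op) (e₁ e₂ : Expr)

/-- Programs: assignment `x := e`, array assignment `a[i] := e`, random assignment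
(`x :=` a uniformly random element of `{0, …, e - 1}`), composition, branching and loops
(the condition holds when its value is not `0`). -/
inductive Prog
  | skip
  | assign (x : ℕ) (e : Expr)
  | store (a : ℕ) (i e : Expr)
  | rand (x : ℕ) (e : Expr)
  | seq (p q : Prog)
  | ite (e : Expr) (p q : Prog)
  | while (e : Expr) (p : Prog)

/-- The memory: the values of the variables and of the array entries. -/
structure Mem where
  var : ℕ → ℕ
  arr : ℕ → ℕ → ℕ

/-- Overwrite a variable. -/
def Mem.setVar (m : Mem) (x v : ℕ) : Mem :=
  { m with var := Function.update m.var x v }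

/-- Overwrite an array entry. -/
def Mem.setArr (m : Mem) (a i v : ℕ) : Mem :=
  { m with arr := Function.update m.arr a (Function.update (m.arr a) i v) }

/-- The value `v`, if it fits into a word. -/
def word (W v : ℕ) : Option ℕ := if v < W then some v else none

/-- The value of an expression; `none` if some intermediate value does not fit into a word. -/
def Expr.eval (W : ℕ) (m : Mem) : Expr → Option ℕ
  | .lit c => word W c
  | .var x => word W (m.var x)
  | .get a i => (i.eval W m).bind fun j => word W (m.arr a j)
  | .bin o e₁ e₂ => (e₁.eval W m).bind fun x => (e₂.eval W m).bind fun y => word W (o.apply x y)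

/-- A configuration: the stack of programs still to be executed, and the memory.
The machine has halted when the stack is empty. -/
structure Config where
  todo : List Prog
  mem : Mem

/-- One step of the machine.  It handles the top of the stack and evaluates at most two expressions
of the program text, so that it stands for a number of word operations which is bounded for each
program.  Halted and stuck configurations stay as they are. -/
noncomputable def step (W : ℕ) : Config → PMF Config
  | ⟨[], m⟩ => PMF.pure ⟨[], m⟩
  | ⟨.skip :: K, m⟩ => PMF.pure ⟨K, m⟩
  | ⟨.assign x e :: K, m⟩ =>
      match e.eval W m with
      | some v => PMF.pure ⟨K, m.setVar x v⟩
      | none => PMF.pure ⟨.assign x e :: K, m⟩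
  | ⟨.store a i e :: K, m⟩ =>
      match i.eval W m, e.eval W m with
      | some j, some v => PMF.pure ⟨K, m.setArr a j v⟩
      | _, _ => PMF.pure ⟨.store a i e :: K, m⟩
  | ⟨.rand x e :: K, m⟩ =>
      match e.eval W m with
      | some (b + 1) =>
          (PMF.uniformOfFintype (Fin (b + 1))).map fun r => ⟨K, m.setVar x r.val⟩
      | _ => PMF.pure ⟨.rand x e :: K, m⟩
  | ⟨.seq p q :: K, m⟩ => PMF.pure ⟨p :: q :: K, m⟩
  | ⟨.ite e p q :: K, m⟩ =>
      match e.eval W m with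
      | some 0 => PMF.pure ⟨q :: K, m⟩
      | some (_ + 1) => PMF.pure ⟨p :: K, m⟩
      | none => PMF.pure ⟨.ite e p q :: K, m⟩
  | ⟨.while e p :: K, m⟩ =>
      match e.eval W m with
      | some 0 => PMF.pure ⟨K, m⟩
      | some (_ + 1) => PMF.pure ⟨p :: .while e p :: K, m⟩
      | none => PMF.pure ⟨.while e p :: K, m⟩

/-- The law of the configuration after `T` steps. -/
noncomputable def run (W : ℕ) : ℕ → Config → PMF Config
  | 0, cfg => PMF.pure cfg
  | T + 1, cfg => (step W cfg).bind (run W T)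

/-- The memory that holds a directed graph with `n` vertices and `m` arcs as a list of arcs:
variables `0` and `1` hold `n` and `k`, and the entries `j < m` of arrays `0` and `1` hold the
numbers of the tail and of the head of the `j`-th arc.  Everything else is `0`. -/
def inputMem {V : Type*} {G : Digraph V} {n m : ℕ} (k : ℕ) (vertexNo : V ≃ Fin n)
    (arcs : Fin m ≃ Arc G) : Mem where
  var x := if x = 0 then n else if x = 1 then k else 0
  arr a j :=
    if h : j < m then
      if a = 0 then (vertexNo (arcs ⟨j, h⟩).tail).val
      else if a = 1 then (vertexNo (arcs ⟨j, h⟩).head).val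
      else 0
    else 0

/-- For every numbering of the vertices and every order of the list of arcs: within `T` steps, with
words below `W`, the program `P` always halts, and the coloring then found in array `2` (entry
`j` is the color of the `j`-th arc) has exactly the law `μ`. -/
def SamplesWithin {V : Type*} (G : Digraph V) (n m k : ℕ) (P : Prog) (W T : ℕ)
    (μ : PMF (Arc G → ℕ)) : Prop :=
  ∀ (vertexNo : V ≃ Fin n) (arcs : Fin m ≃ Arc G),
    (run W T ⟨[P], inputMem k vertexNo arcs⟩).map
        (fun cfg => (cfg.todo, fun a : Arc G => cfg.mem.arr 2 (arcs.symm a).val)) =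
      μ.map fun c => ([], c)

end Machine

end CycleCovers

/-!
Each of the five claims has a direct proof.

* *Possible outputs.*  If the split graph is properly colored, then in each color class of the fused
  graph an arc has one partner at its tail and one at its head (`exists_partner`).  Two fixed point
  free involutions have a common alternating function (`exists_alternating`), and recoloring along
  such a function gives a proper coloring with twice as many colors (`proper_recolor`).
* *Probability of a fixed coloring.*  An output determines the coloring and the alternating division
  it comes from, and it restricts each split to `2 ^ (n k / 2)` of the `(k choose k / 2) ^ n`
  balanced ones, while there are at least `2 ^ (k / 2)` alternating divisions.  The bound follows by
  induction on `l` (`randColoringAux_apply_le`).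
* *Number of cycle covers.*  A permutation is determined by its values outside a set that meets each
  cycle at most once (`perm_eq_of_eqOn_compl`), so that a cycle cover is determined by one root on
  each of its `r` cycles and by the arcs leaving the other `n - r` vertices.
* *Few cycles.*  Having more than `3.5 n / ln k` cycles costs a factor `e ^ (-3.5 n)` in the number
  of cycle covers, hence `e ^ (-3.5 n k)` in the number of colorings all of whose classes are bad.
  Against this stand `2 ^ (n k)` for the choice of roots and `(k ^ k / k!) ^ (2 n) ≤ e ^ (2 n k)`
  from the previous bounds, so that the union bound gives `e ^ (-n k / 2)`.
* *Running time.*  The recursion is unrolled into a loop over the levels that splits and a loop that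
  recolors and fuses (`colorProg`).  A balanced split is drawn arc by arc: the next arc goes to a
  copy with probability proportional to its free places (`ncard_balancedSplits_extension`).  An
  alternating division is drawn by following the tours with tables of partners, with one coin for
  each tour (`walkSet_mark`, `uniformOn_walkSet_coin`).  Each level takes time linear in the number
  of arcs.

The machine is treated backwards, in continuation style: a rule for a program fragment derives the
law of the final output before the fragment from its laws after the fragment (`Law`, `law_levels`).
-/

namespace CycleCovers
open scoped ENNReal

/-! ### Uniform distributions -/

section Uniform

variable {α : Type*} [Finite α] [Inhabited α] {S : Set α}

open Classical in
theorem uniformOn_apply (hS : S.Nonempty) (x : α) :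
    uniformOn S x = if x ∈ S then (S.ncard : ℝ≥0∞)⁻¹ else 0 := by
  rw [uniformOn, dif_pos hS, PMF.uniformOfFinset_apply, Set.ncard_eq_toFinset_card S S.toFinite]
  simp

theorem mem_support_uniformOn (hS : S.Nonempty) {x : α} :
    x ∈ (uniformOn S).support ↔ x ∈ S := by
  classical
  rw [uniformOn, dif_pos hS, PMF.mem_support_uniformOfFinset_iff]
  simp

theorem uniformOn_singleton (x : α) : uniformOn {x} = PMF.pure x := by
  classical
  ext y
  rw [uniformOn_apply (Set.singleton_nonempty x), PMF.pure_apply]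
  simp

/-- A uniform element of `S` can be drawn in two stages: the first decides a property `p` with the
correct odds, `N` out of `b + 1`, and the second draws from the corresponding part of `S`. -/
theorem uniformOn_eq_bind (hS : S.Nonempty) (p : α → Prop) {b N : ℕ}
    (h : {x ∈ S | p x}.ncard * (b + 1) = N * S.ncard) :
    uniformOn S = (PMF.uniformOfFintype (Fin (b + 1))).bind fun r =>
      if r.val < N then uniformOn {x ∈ S | p x} else uniformOn {x ∈ S | ¬ p x} := by
  classical
  have hScard : 0 < S.ncard := (Set.ncard_pos S.toFinite).2 hS
  have hadd : {x ∈ S | p x}.ncard + {x ∈ S | ¬ p x}.ncard = S.ncard := by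
    rw [← Set.ncard_union_eq _ (Set.toFinite _) (Set.toFinite _)]
    · congr 1; ext x; simp only [Set.mem_union, Set.mem_ofPred_eq]; tauto
    · rw [Set.disjoint_left]; rintro x ⟨_, h⟩ ⟨_, h'⟩; exact h' h
  have hN : N ≤ b + 1 := by
    by_contra hlt
    have h2 : {x ∈ S | p x}.ncard ≤ S.ncard := by omega
    nlinarith
  obtain ⟨N', hN'⟩ := Nat.exists_eq_add_of_le hN
  have h' : {x ∈ S | ¬ p x}.ncard * (b + 1) = N' * S.ncard := by
    rw [← hadd] at h ⊢
    have : (b + 1) = N + N' := hN'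
    rw [this] at h ⊢
    nlinarith
  have key : ∀ q M : ℕ, q ≠ 0 → q * (b + 1) = M * S.ncard →
      (S.ncard : ℝ≥0∞)⁻¹ = M * ((b + 1 : ℕ) : ℝ≥0∞)⁻¹ * (q : ℝ≥0∞)⁻¹ := by
    intro q M hq e
    have e1 : (q : ℝ≥0∞) * ((b + 1 : ℕ) : ℝ≥0∞) = M * S.ncard := by exact_mod_cast e
    have hq' : (q : ℝ≥0∞) ≠ 0 := by exact_mod_cast hq
    have hb' : ((b + 1 : ℕ) : ℝ≥0∞) ≠ 0 := by exact_mod_cast Nat.succ_ne_zero b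
    have hs' : (S.ncard : ℝ≥0∞) ≠ 0 := by exact_mod_cast hScard.ne'
    have e2 : (1 : ℝ≥0∞) = M * ((b + 1 : ℕ) : ℝ≥0∞)⁻¹ * (q : ℝ≥0∞)⁻¹ * S.ncard := by
      calc (1 : ℝ≥0∞)
          = (q * ((b + 1 : ℕ) : ℝ≥0∞)) * (((b + 1 : ℕ) : ℝ≥0∞)⁻¹ * (q : ℝ≥0∞)⁻¹) := by
            rw [mul_comm (q : ℝ≥0∞), mul_mul_mul_comm, ENNReal.mul_inv_cancel hb' (by simp),
              ENNReal.mul_inv_cancel hq' (by simp), one_mul]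
        _ = _ := by rw [e1]; ring
    exact (ENNReal.eq_inv_of_mul_eq_one_left e2.symm).symm
  ext x
  rw [PMF.bind_apply, tsum_fintype]
  have hsum : ∀ P Q : ℝ≥0∞, (∑ r : Fin (b + 1), PMF.uniformOfFintype (Fin (b + 1)) r *
      (if r.val < N then P else Q)) = N * ((b + 1 : ℕ) : ℝ≥0∞)⁻¹ * P +
        N' * ((b + 1 : ℕ) : ℝ≥0∞)⁻¹ * Q := by
    intro P Q
    simp only [PMF.uniformOfFintype_apply, Fintype.card_fin, mul_ite]
    rw [Finset.sum_ite, Finset.sum_const, Finset.sum_const, Fin.card_filter_val_lt,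
      Finset.filter_not, Finset.card_sdiff_of_subset (Finset.filter_subset _ _),
      Fin.card_filter_val_lt, Finset.card_univ, Fintype.card_fin, min_eq_right hN, hN',
      Nat.add_sub_cancel_left, nsmul_eq_mul, nsmul_eq_mul, ← mul_assoc, ← mul_assoc]
  have hpush : ∀ r : Fin (b + 1), (if r.val < N then uniformOn {x ∈ S | p x}
      else uniformOn {x ∈ S | ¬ p x}) x = if r.val < N then uniformOn {x ∈ S | p x} x
      else uniformOn {x ∈ S | ¬ p x} x := by intro r; split_ifs <;> rfl
  simp only [hpush]
  rw [hsum]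
  -- a part which is empty contributes nothing, since it is drawn with weight zero
  have part : ∀ (q : α → Prop) (M : ℕ), {x ∈ S | q x}.ncard * (b + 1) = M * S.ncard →
      M * ((b + 1 : ℕ) : ℝ≥0∞)⁻¹ * uniformOn {x ∈ S | q x} x =
        if x ∈ S ∧ q x then (S.ncard : ℝ≥0∞)⁻¹ else 0 := by
    intro q M hM
    by_cases hq : {x ∈ S | q x}.Nonempty
    · rw [uniformOn_apply hq]
      have h0 := ((Set.ncard_pos (Set.toFinite _)).2 hq).ne'
      by_cases hx : x ∈ S ∧ q x
      · rw [if_pos hx, if_pos (show x ∈ {x ∈ S | q x} from hx), key _ _ h0 hM]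
      · rw [if_neg hx, if_neg (show x ∉ {x ∈ S | q x} from hx), mul_zero]
    · have h1 : ¬ (x ∈ S ∧ q x) := fun h => hq ⟨x, h⟩
      rw [Set.not_nonempty_iff_eq_empty.1 hq, Set.ncard_empty, zero_mul] at hM
      have : M = 0 := by rcases Nat.mul_eq_zero.1 hM.symm with h | h <;> omega
      simp [this, h1]
  rw [part p N h, part _ N' h', uniformOn_apply hS]
  by_cases hx : x ∈ S <;> by_cases hp : p x <;> simp [hx, hp]

end Uniform

/-! ### Balanced splits, partners and alternating divisions -/

section Splits

variable {A V : Type*}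

/-- Every vertex is the end (under `f`, the tail map or the head map) of exactly `k` arcs. -/
def RegularMap (f : A → V) (k : ℕ) : Prop := ∀ v, {a | f a = v}.ncard = k

/-- Every vertex is the end of exactly one arc of each of the colors `1, …, k`. -/
def Rainbow (f : A → V) (c : A → ℕ) (k : ℕ) : Prop :=
  ∀ v, ∀ i ∈ Finset.Icc 1 k, ∃! a, c a = i ∧ f a = v

/-- A coloring of the arcs with colors `1, …, k` whose color classes are cycle covers. -/
structure Proper (tail head : A → V) (c : A → ℕ) (k : ℕ) : Prop where
  mem : ∀ a, c a ∈ Finset.Icc 1 k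
  tail : Rainbow tail c k
  head : Rainbow head c k

theorem ncard_add_of_bool [Finite A] (f : A → V) (s : A → Bool) (v : V) :
    {a | f a = v ∧ s a = true}.ncard + {a | f a = v ∧ s a = false}.ncard =
      {a | f a = v}.ncard := by
  rw [← Set.ncard_union_eq _ (Set.toFinite _) (Set.toFinite _)]
  · congr 1; ext a; simp only [Set.mem_union, Set.mem_ofPred_eq]; cases s a <;> simp
  · rw [Set.disjoint_left]; rintro x ⟨_, h⟩ ⟨_, h'⟩; simp [h] at h'

theorem ncard_of_mem_balancedSplits [Finite A] {f : A → V} {k : ℕ} (hf : RegularMap f (2 * k))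
    {s : A → Bool} (hs : s ∈ balancedSplits f) (v : V) (b : Bool) :
    {a | f a = v ∧ s a = b}.ncard = k := by
  have h1 := ncard_add_of_bool f s v
  have h2 := hs v
  rw [hf v] at h1
  cases b <;> omega

theorem regularMap_split [Finite A] {f : A → V} {k : ℕ} (hf : RegularMap f (2 * k))
    {s : A → Bool} (hs : s ∈ balancedSplits f) : RegularMap (fun a => (f a, s a)) k := by
  rintro ⟨v, b⟩
  simpa only [Prod.mk.injEq] using ncard_of_mem_balancedSplits hf hs v b

theorem ncard_balancedSplits [Finite A] [Fintype V] {f : A → V} {k : ℕ}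
    (hf : RegularMap f (2 * k)) :
    (balancedSplits f).ncard = (2 * k).choose k ^ Fintype.card V := by
  classical
  have := Fintype.ofFinite A
  let fib : V → Finset A := fun v => Finset.univ.filter fun a => f a = v
  have hfib : ∀ v, (fib v).card = 2 * k := by
    intro v
    rw [← hf v, ← Set.ncard_coe_finset]; congr 1; ext a; simp [fib]
  have hcard : (Fintype.piFinset fun v => (fib v).powersetCard k).card =
      (2 * k).choose k ^ Fintype.card V := by
    simp [Fintype.card_piFinset, hfib]
  rw [← hcard, ← Set.ncard_coe_finset]
  refine Set.ncard_congr (fun s _ v => Finset.univ.filter fun a => f a = v ∧ s a = true) ?_ ?_ ?_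
  · intro s hs
    simp only [Finset.mem_coe, Fintype.mem_piFinset, Finset.mem_powersetCard]
    intro v
    refine ⟨fun a => by simp +contextual [fib], ?_⟩
    rw [← ncard_of_mem_balancedSplits hf hs v true, ← Set.ncard_coe_finset]
    congr 1; ext a; simp
  · intro s t _ _ h
    funext a
    have := congrArg (fun F => a ∈ F) (congrFun h (f a))
    simpa using this
  · intro B hB
    simp only [Finset.mem_coe, Fintype.mem_piFinset, Finset.mem_powersetCard] at hB
    have hmem : ∀ v a, (f a = v ∧ a ∈ B (f a)) ↔ a ∈ B v := by
      intro v a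
      refine ⟨fun h => h.1 ▸ h.2, fun h => ?_⟩
      have : f a = v := by simpa [fib] using (hB v).1 h
      exact ⟨this, this ▸ h⟩
    refine ⟨fun a => decide (a ∈ B (f a)), fun v => ?_, ?_⟩
    · have h1 := ncard_add_of_bool f (fun a => decide (a ∈ B (f a))) v
      have h2 : {a | f a = v ∧ decide (a ∈ B (f a)) = true}.ncard = k := by
        rw [← (hB v).2, ← Set.ncard_coe_finset]; congr 1; ext a
        simpa using hmem v a
      rw [hf v] at h1
      dsimp only at h1 ⊢
      omega
    · funext v; ext a; simpa using hmem v a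

theorem balancedSplits_nonempty [Finite A] [Finite V] {f : A → V} {k : ℕ}
    (hf : RegularMap f (2 * k)) : (balancedSplits f).Nonempty := by
  have := Fintype.ofFinite V
  refine (Set.ncard_pos (Set.toFinite _)).1 ?_
  rw [ncard_balancedSplits hf]
  exact pow_pos (Nat.choose_pos (by omega)) _

/-- If the split vertices see every color once, then each arc has a unique partner: the arc of the
same color at the other copy of the same vertex. -/
theorem exists_partner {f : A → V} {s : A → Bool} {c : A → ℕ} {k : ℕ}
    (hc : ∀ a, c a ∈ Finset.Icc 1 k) (h : Rainbow (fun a => (f a, s a)) c k) :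
    ∃ τ : A → A, ∀ a b, b = τ a ↔ c b = c a ∧ f b = f a ∧ s b = !s a := by
  choose τ hτ hτ' using fun a => h (f a, !s a) (c a) (hc a)
  refine ⟨τ, fun a b => ⟨?_, fun hb => hτ' a b ⟨hb.1, by simp [hb.2]⟩⟩⟩
  rintro rfl
  simpa using hτ a

section Partner

variable {f : A → V} {s : A → Bool} {c : A → ℕ} {k : ℕ} {τ : A → A}

theorem partner_involutive (hτ : ∀ a b, b = τ a ↔ c b = c a ∧ f b = f a ∧ s b = !s a) (a : A) :
    τ (τ a) = a := by
  have h := (hτ a (τ a)).1 rfl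
  exact ((hτ (τ a) a).2 ⟨h.1.symm, h.2.1.symm, by rw [h.2.2, Bool.not_not]⟩).symm

theorem eq_of_partner (hτ : ∀ a b, b = τ a ↔ c b = c a ∧ f b = f a ∧ s b = !s a) {a b : A}
    (h1 : c a = c b) (h2 : f a = f b) (h3 : s a = s b) : a = b := by
  have h := (hτ b (τ b)).1 rfl
  rw [← partner_involutive hτ b, hτ]
  exact ⟨h1.trans h.1.symm, h2.trans h.2.1.symm, by rw [h.2.2, Bool.not_not, h3]⟩

theorem partner_ne (hτ : ∀ a b, b = τ a ↔ c b = c a ∧ f b = f a ∧ s b = !s a) (a : A) :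
    τ a ≠ a := by
  intro h
  have := ((hτ a a).1 h.symm).2.2
  simp at this

theorem partner_iff (hc : ∀ a, c a ∈ Finset.Icc 1 k) (h : Rainbow (fun a => (f a, s a)) c k)
    (hτ : ∀ a b, b = τ a ↔ c b = c a ∧ f b = f a ∧ s b = !s a) (a b : A) :
    (a ≠ b ∧ c a = c b ∧ f a = f b) ↔ b = τ a := by
  rw [hτ]
  constructor
  · rintro ⟨hne, h1, h2⟩
    refine ⟨h1.symm, h2.symm, ?_⟩
    by_contra hs
    have hs : s b = s a := by cases hb : s b <;> cases ha : s a <;> simp_all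
    exact hne ((h (f a, s a) (c a) (hc a)).unique ⟨rfl, rfl⟩ ⟨h1.symm, by simp [h2, hs]⟩)
  · rintro ⟨h1, h2, h3⟩
    refine ⟨?_, h1.symm, h2.symm⟩
    rintro rfl
    simp at h3

end Partner

/-- A division is alternating when partners at tails and partners at heads lie in different parts. -/
theorem mem_alternatingDivisions {tail head : A → V} {s t : A → Bool} {c : A → ℕ} {k : ℕ}
    {τ η : A → A} (hc : Proper (fun a => (tail a, s a)) (fun a => (head a, t a)) c k)
    (hτ : ∀ a b, b = τ a ↔ c b = c a ∧ tail b = tail a ∧ s b = !s a)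
    (hη : ∀ a b, b = η a ↔ c b = c a ∧ head b = head a ∧ t b = !t a) (d : A → Bool) :
    d ∈ alternatingDivisions tail head c ↔ ∀ a, d (τ a) = !d a ∧ d (η a) = !d a := by
  have h1 := partner_iff hc.mem hc.tail hτ
  have h2 := partner_iff hc.mem hc.head hη
  have hne : ∀ x y : Bool, x ≠ y ↔ y = !x := by decide
  constructor
  · intro hd a
    obtain ⟨h3, h4, h5⟩ := (h1 a (τ a)).2 rfl
    obtain ⟨h6, h7, h8⟩ := (h2 a (η a)).2 rfl
    exact ⟨(hne _ _).1 (hd a _ h3 h4 (.inl h5)), (hne _ _).1 (hd a _ h6 h7 (.inr h8))⟩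
  · intro hd a b hab hcab hor
    rw [hne]
    rcases hor with h | h
    · rw [(h1 a b).1 ⟨hab, hcab, h⟩]; exact (hd a).1
    · rw [(h2 a b).1 ⟨hab, hcab, h⟩]; exact (hd a).2

/-- Two fixed point free involutions have a common alternating function.  An orbit of `τ ∘ η` is
mapped by `τ` to a different orbit (otherwise `τ` or `η` would have a fixed point), so it suffices
to give different values to the two orbits of each such pair. -/
theorem exists_alternating {τ η : A → A} (hτ : ∀ a, τ (τ a) = a) (hη : ∀ a, η (η a) = a)
    (hτ' : ∀ a, τ a ≠ a) (hη' : ∀ a, η a ≠ a) :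
    ∃ d : A → Bool, ∀ a, d (τ a) = !d a ∧ d (η a) = !d a := by
  classical
  let T : Equiv.Perm A := ⟨τ, τ, hτ, hτ⟩
  let H : Equiv.Perm A := ⟨η, η, hη, hη⟩
  let π : Equiv.Perm A := T * H
  have hTT : T * T = 1 := Equiv.ext hτ
  have hHH : H * H = 1 := Equiv.ext hη
  have hconj : T * π * T⁻¹ = π⁻¹ := by
    have h1 : T⁻¹ = T := inv_eq_of_mul_eq_one_left hTT
    have h2 : H⁻¹ = H := inv_eq_of_mul_eq_one_left hHH
    simp only [π, mul_inv_rev, h1, h2, ← mul_assoc, hTT, one_mul]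
  have hTpow : ∀ (i : ℤ) (a : A), τ ((π ^ i) a) = (π ^ (-i)) (τ a) := by
    intro i a
    have h : T * π ^ i = π ^ (-i) * T := by
      rw [zpow_neg, ← inv_zpow, ← hconj, conj_zpow, inv_mul_cancel_right]
    exact congrArg (fun p : Equiv.Perm A => p a) h
  have hnot : ∀ a, ¬ π.SameCycle a (τ a) := by
    rintro a ⟨i, hi⟩
    rcases Int.even_or_odd' i with ⟨j, rfl | rfl⟩
    · apply hτ' ((π ^ j) a)
      rw [hTpow, ← hi, ← Equiv.Perm.mul_apply, ← zpow_add]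
      congr 2; ring
    · apply hη' ((π ^ j) a)
      have h1 : τ (η ((π ^ j) a)) = (π ^ (j + 1)) a := by
        rw [add_comm, zpow_add, zpow_one]; rfl
      have h2 : τ ((π ^ j) a) = (π ^ (j + 1)) a := by
        rw [hTpow, ← hi, ← Equiv.Perm.mul_apply, ← zpow_add]
        congr 2; ring
      have := congrArg τ (h1.trans h2.symm)
      rwa [hτ, hτ] at this
  let Q := Quotient (Equiv.Perm.SameCycle.setoid π)
  let q : A → Q := fun a => Quotient.mk _ a
  let r : Q → Q → Prop := WellOrderingRel
  have hq : ∀ a b, q a = q b ↔ π.SameCycle a b := fun a b => Quotient.eq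
  have hqη : ∀ a, q (η a) = q (τ a) := by
    intro a
    rw [hq]
    exact ⟨1, by rw [zpow_one]; exact congrArg τ (hη a)⟩
  refine ⟨fun a => decide (r (q a) (q (τ a))), fun a => ?_⟩
  have hlt : ∀ x y : Q, x ≠ y → decide (r y x) = !decide (r x y) := by
    intro x y hxy
    rcases trichotomous_of r x y with h | h | h
    · simp [h, asymm_of r h]
    · exact absurd h hxy
    · simp [h, asymm_of r h]
  have hne : q a ≠ q (τ a) := fun h => hnot a ((hq _ _).1 h)
  have hτq : q (τ (η a)) = q a := by
    rw [hq]; exact ⟨-1, by rw [zpow_neg_one, Equiv.Perm.inv_eq_iff_eq]; rfl⟩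
  constructor
  · simp only [hτ]; exact hlt _ _ hne
  · simp only [hqη, hτq]; exact hlt _ _ hne

end Splits

/-! ### The recoloring step, and the possible outputs -/

section Recolor

variable {A V : Type*}

/-- The arcs of the part `d` of the coloring `c` get new colors, `k` above the old ones. -/
def recolor (c : A → ℕ) (d : A → Bool) (k : ℕ) : A → ℕ :=
  fun a => if d a = true then c a + k else c a

/-- The two arcs of an old color at a vertex lie in different parts, so that one keeps its color and
the other gets the new one. -/
theorem rainbow_recolor {f : A → V} {s d : A → Bool} {c : A → ℕ} {k : ℕ}
    (hc : ∀ a, c a ∈ Finset.Icc 1 k) (h : Rainbow (fun a => (f a, s a)) c k)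
    (hd : ∀ a b, a ≠ b → c a = c b → f a = f b → d a ≠ d b) :
    Rainbow f (recolor c d k) (2 * k) := by
  intro v i hi
  rw [Finset.mem_Icc] at hi
  obtain ⟨i₀, hi₀, e, hie⟩ : ∃ i₀ ∈ Finset.Icc 1 k, ∃ e : Bool,
      i = if e = true then i₀ + k else i₀ := by
    by_cases hik : i ≤ k
    · exact ⟨i, Finset.mem_Icc.2 ⟨hi.1, hik⟩, false, by simp⟩
    · exact ⟨i - k, Finset.mem_Icc.2 ⟨by omega, by omega⟩, true, by simp; omega⟩
  have hiff : ∀ a, recolor c d k a = i ↔ c a = i₀ ∧ d a = e := by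
    intro a
    have h1 := Finset.mem_Icc.1 (hc a)
    have h2 := Finset.mem_Icc.1 hi₀
    rw [hie, recolor]
    cases d a <;> cases e <;> simp <;> omega
  obtain ⟨a, ⟨ha, ha'⟩, -⟩ := h (v, false) i₀ hi₀
  obtain ⟨b, ⟨hb, hb'⟩, -⟩ := h (v, true) i₀ hi₀
  simp only [Prod.mk.injEq] at ha' hb'
  have hab : a ≠ b := by rintro rfl; simp [ha'.2] at hb'
  have hdab := hd a b hab (ha.trans hb.symm) (ha'.1.trans hb'.1.symm)
  obtain ⟨x, hx⟩ : ∃ x, c x = i₀ ∧ f x = v ∧ d x = e := by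
    by_cases hda : d a = e
    · exact ⟨a, ha, ha'.1, hda⟩
    · exact ⟨b, hb, hb'.1, by revert hda hdab; cases d a <;> cases d b <;> cases e <;> simp⟩
  refine ⟨x, ⟨(hiff x).2 ⟨hx.1, hx.2.2⟩, hx.2.1⟩, ?_⟩
  rintro y ⟨hy, hy'⟩
  rw [hiff] at hy
  by_contra hne
  exact hd y x hne (hy.1.trans hx.1.symm) (hy'.trans hx.2.1.symm) (hy.2.trans hx.2.2.symm)

theorem proper_recolor {tail head : A → V} {s t d : A → Bool} {c : A → ℕ} {k : ℕ}
    (hc : Proper (fun a => (tail a, s a)) (fun a => (head a, t a)) c k)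
    (hd : d ∈ alternatingDivisions tail head c) :
    Proper tail head (recolor c d k) (2 * k) where
  mem a := by
    have := Finset.mem_Icc.1 (hc.mem a)
    rw [Finset.mem_Icc, recolor]
    split_ifs <;> omega
  tail := rainbow_recolor hc.mem hc.tail fun a b h1 h2 h3 => hd a b h1 h2 (.inl h3)
  head := rainbow_recolor hc.mem hc.head fun a b h1 h2 h3 => hd a b h1 h2 (.inr h3)

theorem recolor_injective {c c' : A → ℕ} {d d' : A → Bool} {k : ℕ}
    (hc : ∀ a, c a ∈ Finset.Icc 1 k) (hc' : ∀ a, c' a ∈ Finset.Icc 1 k)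
    (h : recolor c d k = recolor c' d' k) : c = c' ∧ d = d' := by
  have key : ∀ a, c a = c' a ∧ d a = d' a := by
    intro a
    have h1 := Finset.mem_Icc.1 (hc a)
    have h2 := Finset.mem_Icc.1 (hc' a)
    have h3 := congrFun h a
    revert h3
    rw [recolor, recolor]
    cases d a <;> cases d' a <;> simp <;> omega
  exact ⟨funext fun a => (key a).1, funext fun a => (key a).2⟩

theorem alternatingDivisions_nonempty {tail head : A → V} {s t : A → Bool} {c : A → ℕ} {k : ℕ}
    (hc : Proper (fun a => (tail a, s a)) (fun a => (head a, t a)) c k) :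
    (alternatingDivisions tail head c).Nonempty := by
  obtain ⟨τ, hτ⟩ := exists_partner hc.mem hc.tail
  obtain ⟨η, hη⟩ := exists_partner hc.mem hc.head
  obtain ⟨d, hd⟩ := exists_alternating (partner_involutive hτ) (partner_involutive hη)
    (partner_ne hτ) (partner_ne hη)
  exact ⟨d, (mem_alternatingDivisions hc hτ hη d).2 hd⟩

theorem proper_one {tail head : A → V} (ht : RegularMap tail 1) (hh : RegularMap head 1) :
    Proper tail head (fun _ => 1) 1 := by
  have key : ∀ f : A → V, RegularMap f 1 → Rainbow f (fun _ => 1) 1 := by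
    intro f hf v i hi
    obtain ⟨a, ha⟩ := Set.ncard_eq_one.1 (hf v)
    have hi : 1 = i := by have := Finset.mem_Icc.1 hi; omega
    refine ⟨a, ⟨hi, ?_⟩, fun b hb => ?_⟩
    · have : a ∈ {a | f a = v} := by rw [ha]; rfl
      exact this
    · have : b ∈ {a | f a = v} := hb.2
      rwa [ha] at this
  exact ⟨fun _ => by simp, key _ ht, key _ hh⟩

theorem randColoringAux_succ [Finite A] (l : ℕ) (tail head : A → V) :
    randColoringAux (l + 1) tail head =
      (uniformOn (balancedSplits tail)).bind fun s =>
      (uniformOn (balancedSplits head)).bind fun t =>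
      (randColoringAux l (fun a => (tail a, s a)) (fun a => (head a, t a))).bind fun c =>
      (uniformOn (alternatingDivisions tail head c)).bind fun d =>
      PMF.pure (recolor c d (2 ^ l)) := rfl

theorem proper_of_mem_support [Finite A] (l : ℕ) {V : Type*} [Finite V] {tail head : A → V}
    (ht : RegularMap tail (2 ^ l)) (hh : RegularMap head (2 ^ l)) {col : A → ℕ}
    (hcol : col ∈ (randColoringAux l tail head).support) : Proper tail head col (2 ^ l) := by
  induction l generalizing V col with
  | zero =>
    rw [randColoringAux, PMF.mem_support_pure_iff] at hcol
    rw [hcol]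
    exact proper_one ht hh
  | succ l ih =>
    rw [pow_succ'] at ht hh
    rw [randColoringAux_succ] at hcol
    simp only [PMF.mem_support_bind_iff, PMF.mem_support_pure_iff] at hcol
    obtain ⟨s, hs, t, ht', c, hc, d, hd, rfl⟩ := hcol
    rw [mem_support_uniformOn (balancedSplits_nonempty ht)] at hs
    rw [mem_support_uniformOn (balancedSplits_nonempty hh)] at ht'
    have hp := ih (regularMap_split ht hs) (regularMap_split hh ht') hc
    rw [mem_support_uniformOn (alternatingDivisions_nonempty hp)] at hd
    rw [pow_succ']
    exact proper_recolor hp hd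

end Recolor

/-! ### The probability of a fixed coloring -/

section Probability

variable {A V : Type*}

theorem bind_apply_le_of_eq {α β : Type*} (p : PMF α) (f : α → PMF β) (x : α) (y : β)
    (h : ∀ z ∈ p.support, z ≠ x → f z y = 0) : (p.bind f) y ≤ p x * f x y := by
  rw [PMF.bind_apply]
  refine (tsum_eq_single x fun z hz => ?_).le
  by_cases hzp : z ∈ p.support
  · rw [h z hzp hz, mul_zero]
  · rw [(PMF.apply_eq_zero_iff p z).2 hzp, zero_mul]

/-- If `y` can only arise from a draw in `C`, then its probability is at most the probability of `C`
times the largest conditional probability. -/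
theorem bind_uniformOn_apply_le {α β : Type*} [Finite α] [Inhabited α] {S : Set α}
    (hS : S.Nonempty) (f : α → PMF β) (y : β) (C : Set α) (B : ℝ≥0∞)
    (h : ∀ x ∈ S, x ∈ C → f x y ≤ B) (h' : ∀ x ∈ S, x ∉ C → f x y = 0) :
    ((uniformOn S).bind f) y ≤ C.ncard * (S.ncard : ℝ≥0∞)⁻¹ * B := by
  classical
  have := Fintype.ofFinite α
  rw [PMF.bind_apply, tsum_fintype]
  calc ∑ x, uniformOn S x * f x y
      ≤ ∑ x, if x ∈ C then (S.ncard : ℝ≥0∞)⁻¹ * B else 0 := by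
        refine Finset.sum_le_sum fun x _ => ?_
        rw [uniformOn_apply hS]
        by_cases hx : x ∈ S
        · by_cases hC : x ∈ C
          · rw [if_pos hx, if_pos hC]; gcongr; exact h x hx hC
          · rw [h' x hx hC, mul_zero]; positivity
        · rw [if_neg hx, zero_mul]; positivity
    _ = _ := by
        rw [← Finset.sum_filter, Finset.sum_const, nsmul_eq_mul, mul_assoc,
          ← Set.ncard_coe_finset]
        congr 3; ext x; simp

/-- A split under which `c` uses every color once at each copy separates the two arcs of each
color at each vertex, so that it is determined by its values on one part of an alternating
division. -/
theorem ncard_compatible_le [Finite A] [Fintype V] {f : A → V} {c : A → ℕ} {d : A → Bool} {k : ℕ}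
    (hc : ∀ a, c a ∈ Finset.Icc 1 k) (h : Rainbow f (recolor c d k) (2 * k)) :
    {s : A → Bool | Rainbow (fun a => (f a, s a)) c k}.ncard ≤ 2 ^ (Fintype.card V * k) := by
  classical
  have := Fintype.ofFinite A
  have hB : Fintype.card {a // d a = false} ≤ Fintype.card V * k := by
    rw [← Fintype.card_fin k, ← Fintype.card_prod]
    refine Fintype.card_le_of_injective
      (fun a => (f a.1, (⟨c a.1 - 1, by have := Finset.mem_Icc.1 (hc a.1); omega⟩ : Fin k))) ?_
    rintro ⟨a, ha⟩ ⟨b, hb⟩ hab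
    simp only [Prod.mk.injEq, Fin.mk.injEq] at hab
    have h1 := Finset.mem_Icc.1 (hc a)
    have h2 := Finset.mem_Icc.1 (hc b)
    have hcab : c b = c a := by omega
    have hu := h (f a) (c a) (Finset.mem_Icc.2 ⟨h1.1, by omega⟩)
    exact Subtype.ext (hu.unique ⟨by simp [recolor, ha], rfl⟩
      ⟨by simp [recolor, hb, hcab], hab.1.symm⟩)
  calc _ ≤ (Set.univ : Set ({a // d a = false} → Bool)).ncard := by
        refine Set.ncard_le_ncard_of_injOn (fun s a => s a.1) (fun _ _ => Set.mem_univ _) ?_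
          (Set.toFinite _)
        intro s hs s' hs' hss
        have hF : ∀ a, d a = false → s a = s' a := fun a ha => congrFun hss ⟨a, ha⟩
        funext b
        cases hdb : d b
        · exact hF b hdb
        have hcb := Finset.mem_Icc.1 (hc b)
        obtain ⟨a, ⟨ha, hfa⟩, -⟩ := h (f b) (c b) (Finset.mem_Icc.2 ⟨hcb.1, by omega⟩)
        have hca := Finset.mem_Icc.1 (hc a)
        have had : d a = false := by
          by_contra hne
          simp only [Bool.not_eq_false] at hne
          rw [recolor, if_pos hne] at ha
          omega
        rw [recolor, had, if_neg (by simp)] at ha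
        have hab : a ≠ b := by rintro rfl; simp [had] at hdb
        have hsep : ∀ s : A → Bool, Rainbow (fun a => (f a, s a)) c k → s b = !s a := by
          intro s hs
          have : s b ≠ s a := fun hsb => hab
            ((hs (f b, s b) (c b) (hc b)).unique ⟨ha, by simp [hfa, hsb]⟩ ⟨rfl, rfl⟩)
          revert this; cases s b <;> cases s a <;> simp
        rw [hsep s hs, hsep s' hs', hF a had]
    _ = 2 ^ Fintype.card {a // d a = false} := by
        rw [Set.ncard_univ, Nat.card_eq_fintype_card]; simp
    _ ≤ _ := Nat.pow_le_pow_right (by omega) hB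

/-- Within each color class the two parts of an alternating division can be exchanged
independently. -/
theorem two_pow_le_ncard_alternatingDivisions [Finite A] {V' : Type*} [Nonempty V']
    {tail head : A → V} {c : A → ℕ} {k : ℕ} {f : A → V'} (hc : Rainbow f c k)
    (h : (alternatingDivisions tail head c).Nonempty) :
    2 ^ k ≤ (alternatingDivisions tail head c).ncard := by
  obtain ⟨d, hd⟩ := h
  have h1 : (Set.univ : Set (Fin k → Bool)).ncard = 2 ^ k := by
    rw [Set.ncard_univ, Nat.card_eq_fintype_card]; simp
  rw [← h1]
  let G : (Fin k → Bool) → ℕ → Bool := fun g i => if h : i - 1 < k then g ⟨i - 1, h⟩ else false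
  refine Set.ncard_le_ncard_of_injOn (fun g a => xor (d a) (G g (c a))) ?_ ?_ (Set.toFinite _)
  · intro g _ a b hab hcab hor
    have := hd a b hab hcab hor
    simpa [hcab] using this
  · intro g _ g' _ hgg
    funext i
    obtain ⟨v⟩ := ‹Nonempty V'›
    obtain ⟨a, ⟨ha, -⟩, -⟩ := hc v (i + 1) (Finset.mem_Icc.2 ⟨by omega, i.2⟩)
    have := congrFun hgg a
    simpa [G, ha] using this

/-- The bound for the probability of a fixed coloring. -/
noncomputable def colorBound (n k : ℕ) : ℝ :=
  ((k : ℝ) ^ k / (k.factorial : ℝ) ^ 2) ^ n / 2 ^ (k - 1)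

theorem colorBound_nonneg (n k : ℕ) : 0 ≤ colorBound n k := by
  unfold colorBound; positivity

/-- The recursion for `colorBound`: the splits of the tails and of the heads each contribute the
factor `2 ^ (n k) / (2k choose k) ^ n`, and the choice of the recolored parts `2 ^ (-k)`. -/
theorem colorBound_double (n k : ℕ) (hk : 0 < k) :
    (2 : ℝ) ^ (n * k) / ((2 * k).choose k : ℝ) ^ n * ((2 : ℝ) ^ (n * k) /
      ((2 * k).choose k : ℝ) ^ n * (colorBound (2 * n) k * ((2 : ℝ) ^ k)⁻¹)) =
    colorBound n (2 * k) := by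
  have hch : ((2 * k).choose k : ℝ) = (2 * k).factorial / ((k.factorial : ℝ) * k.factorial) := by
    rw [Nat.cast_choose ℝ (by omega : k ≤ 2 * k)]
    congr 3; congr 1; omega
  obtain ⟨j, rfl⟩ := Nat.exists_eq_add_of_lt hk
  have h1 : (2 * (0 + j + 1)) - 1 = j + (0 + j + 1) := by omega
  have h2 : (0 + j + 1) - 1 = j := by omega
  unfold colorBound
  rw [hch, h1, h2]
  generalize hK : 0 + j + 1 = K
  have hf : (K.factorial : ℝ) ≠ 0 := by positivity
  have hf2 : ((2 * K).factorial : ℝ) ≠ 0 := by positivity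
  push_cast
  have h3 : (2 : ℝ) ^ (n * K) = (2 ^ K) ^ n := by rw [mul_comm, pow_mul]
  have h4 : ((K : ℝ) ^ K / (K.factorial : ℝ) ^ 2) ^ (2 * n) =
      (((K : ℝ) ^ K / (K.factorial : ℝ) ^ 2) ^ 2) ^ n := pow_mul _ _ _
  have h5 : (2 * (K : ℝ)) ^ (2 * K) = (2 ^ K * (K : ℝ) ^ K) ^ 2 := by
    rw [pow_mul', mul_pow]
  rw [h3, h4, h5, pow_add, ← div_pow]
  have h6 : (2 ^ K * (K : ℝ) ^ K) ^ 2 / ((2 * K).factorial : ℝ) ^ 2 =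
      2 ^ K / (((2 * K).factorial : ℝ) / (K.factorial * K.factorial)) *
        (2 ^ K / (((2 * K).factorial : ℝ) / (K.factorial * K.factorial))) *
        ((K : ℝ) ^ K / (K.factorial : ℝ) ^ 2) ^ 2 := by
    field_simp
  rw [h6, mul_pow, mul_pow]
  field_simp

/-- A given coloring determines the coloring of the split graph and the recolored parts, and the
splits have to separate the two arcs of each color at each vertex; the bounds for these three
events multiply. -/
theorem randColoringAux_apply_le [Finite A] (l : ℕ) {V : Type*} [Fintype V] [Nonempty V]
    {tail head : A → V} (ht : RegularMap tail (2 ^ l)) (hh : RegularMap head (2 ^ l))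
    (col : A → ℕ) :
    randColoringAux l tail head col ≤ ENNReal.ofReal (colorBound (Fintype.card V) (2 ^ l)) := by
  classical
  induction l generalizing V col with
  | zero => simpa [colorBound] using PMF.coe_le_one _ _
  | succ l ih =>
    by_cases hcol : col ∈ (randColoringAux (l + 1) tail head).support
    swap
    · rw [(PMF.apply_eq_zero_iff _ _).2 hcol]; exact zero_le
    have hpcol := proper_of_mem_support _ ht hh hcol
    rw [pow_succ'] at ht hh hpcol ⊢
    set K := 2 ^ l with hK
    have hK0 : 0 < K := by positivity
    rw [randColoringAux_succ] at hcol
    simp only [PMF.mem_support_bind_iff, PMF.mem_support_pure_iff] at hcol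
    obtain ⟨s₀, hs₀, t₀, ht₀, c, hc, d, hd, rfl⟩ := hcol
    rw [mem_support_uniformOn (balancedSplits_nonempty ht)] at hs₀
    rw [mem_support_uniformOn (balancedSplits_nonempty hh)] at ht₀
    have hp := proper_of_mem_support l (regularMap_split ht hs₀) (regularMap_split hh ht₀) hc
    clear hs₀ ht₀ hc hd
    have hcm := hp.mem
    clear hp
    -- the last two stages, for given splits
    have inner : ∀ s ∈ balancedSplits tail, ∀ t ∈ balancedSplits head,
        ((randColoringAux l (fun a => (tail a, s a)) (fun a => (head a, t a))).bind fun c =>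
          (uniformOn (alternatingDivisions tail head c)).bind fun d =>
          PMF.pure (recolor c d (2 ^ l))) (recolor c d K) ≤
        randColoringAux l (fun a => (tail a, s a)) (fun a => (head a, t a)) c *
          ((2 : ℝ≥0∞) ^ K)⁻¹ := by
      intro s hs t ht'
      by_cases hcs : c ∈ (randColoringAux l (fun a => (tail a, s a))
          (fun a => (head a, t a))).support
      · have hp := proper_of_mem_support l (regularMap_split ht hs) (regularMap_split hh ht') hcs
        have hne := alternatingDivisions_nonempty hp
        refine (bind_apply_le_of_eq _ _ c _ ?_).trans ?_
        · intro c' hc' hcc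
          rw [PMF.apply_eq_zero_iff]
          simp only [PMF.mem_support_bind_iff, PMF.mem_support_pure_iff]
          rintro ⟨d', -, h⟩
          have hp' := proper_of_mem_support l (regularMap_split ht hs)
            (regularMap_split hh ht') hc'
          exact hcc (recolor_injective hcm hp'.mem h).1.symm
        · gcongr
          refine (bind_uniformOn_apply_le hne _ _ {d} 1 (fun _ _ _ => PMF.coe_le_one _ _)
            ?_).trans ?_
          · intro d' _ hdd
            rw [PMF.apply_eq_zero_iff, PMF.mem_support_pure_iff]
            exact fun h => hdd (recolor_injective hcm hcm h).2.symm
          · rw [Set.ncard_singleton, Nat.cast_one, one_mul, mul_one, ENNReal.inv_le_inv]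
            exact_mod_cast two_pow_le_ncard_alternatingDivisions hp.tail hne
      · refine (bind_apply_le_of_eq _ _ c _ ?_).trans ?_
        · intro c' hc' hcc
          rw [PMF.apply_eq_zero_iff]
          simp only [PMF.mem_support_bind_iff, PMF.mem_support_pure_iff]
          rintro ⟨d', -, h⟩
          have hp' := proper_of_mem_support l (regularMap_split ht hs)
            (regularMap_split hh ht') hc'
          exact hcc (recolor_injective hcm hp'.mem h).1.symm
        · rw [(PMF.apply_eq_zero_iff _ _).2 hcs, zero_mul]; exact zero_le
    have inner_zero : ∀ s ∈ balancedSplits tail, ∀ t ∈ balancedSplits head,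
        ¬ (Rainbow (fun a => (tail a, s a)) c K ∧ Rainbow (fun a => (head a, t a)) c K) →
        ((randColoringAux l (fun a => (tail a, s a)) (fun a => (head a, t a))).bind fun c =>
          (uniformOn (alternatingDivisions tail head c)).bind fun d =>
          PMF.pure (recolor c d (2 ^ l))) (recolor c d K) = 0 := by
      intro s hs t ht' hn
      refine le_antisymm ((inner s hs t ht').trans ?_) zero_le
      rw [(PMF.apply_eq_zero_iff _ _).2, zero_mul]
      intro hcs
      have hp := proper_of_mem_support l (regularMap_split ht hs) (regularMap_split hh ht') hcs
      exact hn ⟨hp.tail, hp.head⟩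
    have hcard : Fintype.card (V × Bool) = 2 * Fintype.card V := by
      rw [Fintype.card_prod, Fintype.card_bool, mul_comm]
    set n := Fintype.card V with hn
    -- each split is compatible with `c` with probability at most `q`
    set q : ℝ≥0∞ := ENNReal.ofReal (2 ^ (n * K) / ((2 * K).choose K : ℝ) ^ n) with hq
    have hchoose : (0 : ℝ) < ((2 * K).choose K : ℝ) ^ n := by
      have := Nat.choose_pos (show K ≤ 2 * K by omega)
      positivity
    have hq' : ∀ f : A → V, RegularMap f (2 * K) → Rainbow f (recolor c d K) (2 * K) →
        ({s : A → Bool | Rainbow (fun a => (f a, s a)) c K}.ncard : ℝ≥0∞) *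
          ((balancedSplits f).ncard : ℝ≥0∞)⁻¹ ≤ q := by
      intro f hf hr
      rw [ncard_balancedSplits hf, hq, ENNReal.ofReal_div_of_pos hchoose, div_eq_mul_inv]
      have := ncard_compatible_le hcm hr
      gcongr
      · rw [← ENNReal.ofReal_natCast]
        apply ENNReal.ofReal_le_ofReal
        exact_mod_cast this
      · rw [← ENNReal.ofReal_natCast]
        apply ENNReal.ofReal_le_ofReal
        push_cast
        exact le_rfl
    rw [← colorBound_double n K hK0, ENNReal.ofReal_mul (by positivity),
      ENNReal.ofReal_mul (by positivity), ENNReal.ofReal_mul (colorBound_nonneg _ _), ← hq]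
    rw [randColoringAux_succ]
    refine (bind_uniformOn_apply_le (balancedSplits_nonempty ht) _ _
      {s | Rainbow (fun a => (tail a, s a)) c K}
      (q * (ENNReal.ofReal (colorBound (2 * n) K) * ENNReal.ofReal (2 ^ K)⁻¹)) ?_ ?_).trans ?_
    · intro s hs _
      refine (bind_uniformOn_apply_le (balancedSplits_nonempty hh) _ _
        {t | Rainbow (fun a => (head a, t a)) c K}
        (ENNReal.ofReal (colorBound (2 * n) K) * ENNReal.ofReal (2 ^ K)⁻¹) ?_ ?_).trans ?_
      · intro t ht' _
        refine (inner s hs t ht').trans ?_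
        have := ih (regularMap_split ht hs) (regularMap_split hh ht') c
        rw [hcard] at this
        gcongr
        rw [ENNReal.ofReal_inv_of_pos (by positivity), ENNReal.ofReal_pow (by norm_num)]
        simp
      · intro t ht' hn
        exact inner_zero s hs t ht' fun h => hn h.2
      · gcongr
        exact hq' head hh hpcol.head
    · intro s hs hn
      rw [PMF.apply_eq_zero_iff, PMF.mem_support_bind_iff]
      rintro ⟨t, ht', h⟩
      rw [mem_support_uniformOn (balancedSplits_nonempty hh)] at ht'
      exact (PMF.mem_support_iff _ _).1 h (inner_zero s hs t ht' fun h => hn h.1)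
    · gcongr
      exact hq' tail ht hpcol.tail

end Probability

/-! ### Cycle covers with a given number of cycles -/

section Covers

variable {V : Type*} {G : Digraph V} {k : ℕ}

theorem regularMap_tail [Finite V] (hG : IsRegular G k) :
    RegularMap (Arc.tail : Arc G → V) k := by
  intro v
  rw [← (hG v).1]
  refine Set.ncard_congr (fun a _ => a.head) ?_ ?_ ?_
  · rintro ⟨⟨x, y⟩, h⟩ rfl; exact h
  · rintro ⟨⟨x, y⟩, h⟩ ⟨⟨x', y'⟩, h'⟩ rfl hx rfl
    exact Subtype.ext (Prod.ext hx.symm rfl)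
  · intro w hw; exact ⟨⟨(v, w), hw⟩, rfl, rfl⟩

theorem regularMap_head [Finite V] (hG : IsRegular G k) :
    RegularMap (Arc.head : Arc G → V) k := by
  intro v
  rw [← (hG v).2]
  refine Set.ncard_congr (fun a _ => a.tail) ?_ ?_ ?_
  · rintro ⟨⟨x, y⟩, h⟩ rfl; exact h
  · rintro ⟨⟨x, y⟩, h⟩ ⟨⟨x', y'⟩, h'⟩ rfl hx rfl
    exact Subtype.ext (Prod.ext rfl hx.symm)
  · intro w hw; exact ⟨⟨(w, v), hw⟩, rfl, rfl⟩

theorem Proper.isCycleCoverColoring {c : Arc G → ℕ} (h : Proper Arc.tail Arc.head c k) :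
    IsCycleCoverColoring G k c :=
  ⟨h.mem, fun i hi v => ⟨h.tail v i hi, h.head v i hi⟩⟩

/-- A cycle cover, as a permutation of the vertices. -/
theorem IsCycleCover.exists_perm [Finite V] {F : Set (Arc G)} (hF : IsCycleCover G F) :
    ∃ σ : Equiv.Perm V, ∀ a : Arc G, a ∈ F ↔ σ a.tail = a.head := by
  choose next hnext hnext' using fun v => (hF v).1
  have hinj : Function.Injective fun v => (next v).head := by
    intro u v h
    have : next u = next v :=
      (hF _).2.unique ⟨(hnext u).1, rfl⟩ ⟨(hnext v).1, h.symm⟩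
    rw [← (hnext u).2, ← (hnext v).2, this]
  refine ⟨Equiv.ofBijective _ (Finite.injective_iff_bijective.1 hinj), fun a => ?_⟩
  simp only [Equiv.ofBijective_apply]
  constructor
  · intro ha; rw [← hnext' a.tail a ⟨ha, rfl⟩]
  · intro h
    have : a = next a.tail := Subtype.ext (Prod.ext (hnext a.tail).2.symm h.symm)
    rw [this]; exact (hnext _).1

/-- A permutation is determined by its values off a set `R` that contains at most one point of each
cycle: from `σ ρ`, for `ρ ∈ R`, both permutations follow the same path outside `R`, up to `ρ`. -/
theorem perm_eq_of_eqOn_compl [Finite V] {σ σ' : Equiv.Perm V} {R : Set V}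
    (hσ : ∀ x ∈ R, ∀ y ∈ R, σ.SameCycle x y → x = y)
    (hσ' : ∀ x ∈ R, ∀ y ∈ R, σ'.SameCycle x y → x = y)
    (h : ∀ v, v ∉ R → σ v = σ' v) : σ = σ' := by
  classical
  ext ρ
  by_cases hρ : ρ ∈ R
  swap
  · exact h ρ hρ
  have hex : ∃ j : ℕ, (σ ^ j) (σ ρ) = ρ := by
    have hs : σ.SameCycle (σ ρ) ρ := (Equiv.Perm.sameCycle_apply_left).2 (Equiv.Perm.SameCycle.refl _ _)
    obtain ⟨j, hj⟩ := hs.exists_nat_pow_eq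
    exact ⟨j, hj⟩
  have hmin : ∀ i < Nat.find hex, (σ ^ i) (σ ρ) ∉ R := by
    intro i hi hR
    refine Nat.find_min hex hi (hσ _ hR _ hρ ?_)
    rw [Equiv.Perm.sameCycle_pow_left, Equiv.Perm.sameCycle_apply_left]
  have hpath : ∀ i ≤ Nat.find hex, (σ' ^ i) (σ ρ) = (σ ^ i) (σ ρ) := by
    intro i
    induction i with
    | zero => intro _; rfl
    | succ i ih =>
      intro hi
      rw [pow_succ', pow_succ', Equiv.Perm.mul_apply, Equiv.Perm.mul_apply, ih (by omega),
        h _ (hmin i (by omega))]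
  have hend := hpath _ le_rfl
  rw [Nat.find_spec hex] at hend
  have hsame : σ'.SameCycle (σ'.symm (σ ρ)) ρ := by
    rw [Equiv.Perm.sameCycle_symm_apply_left, ← Equiv.Perm.sameCycle_pow_left (n := Nat.find hex),
      hend]
  by_cases hu : σ'.symm (σ ρ) ∈ R
  · have := hσ' _ hu _ hρ hsame
    rw [Equiv.symm_apply_eq] at this
    exact this
  · have h1 := h _ hu
    rw [Equiv.apply_symm_apply] at h1
    rw [σ.injective h1] at hu
    exact absurd hρ hu

/-- One point from each component: at most one from each cycle. -/
theorem exists_roots [Fintype V] (F : Set (Arc G)) :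
    ∃ R : Finset V, R.card = numComponents G F ∧ ∀ σ : Equiv.Perm V,
      (∀ v, ∃ a ∈ F, a.tail = v ∧ a.head = σ v) →
      ∀ x ∈ R, ∀ y ∈ R, σ.SameCycle x y → x = y := by
  classical
  let H := SimpleGraph.fromRel fun u v : V => ∃ a ∈ F, a.tail = u ∧ a.head = v
  have hout : Function.Injective fun C : H.ConnectedComponent => C.out := by
    intro C C' h
    have h1 : H.connectedComponentMk C.out = C := Quot.out_eq C
    have h2 : H.connectedComponentMk C'.out = C' := Quot.out_eq C'
    rw [← h1, ← h2]; exact congrArg _ h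
  have := Fintype.ofFinite H.ConnectedComponent
  refine ⟨Finset.univ.map ⟨_, hout⟩, ?_, ?_⟩
  · rw [Finset.card_map, Finset.card_univ, numComponents, Nat.card_eq_fintype_card]
  · intro σ hσ x hx y hy hxy
    simp only [Finset.mem_map, Finset.mem_univ, true_and, Function.Embedding.coeFn_mk] at hx hy
    obtain ⟨C, rfl⟩ := hx
    obtain ⟨C', rfl⟩ := hy
    have h1 : H.connectedComponentMk C.out = C := Quot.out_eq C
    have h2 : H.connectedComponentMk C'.out = C' := Quot.out_eq C'
    have hstep : ∀ v, H.Reachable v (σ v) := by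
      intro v
      by_cases hv : v = σ v
      · rw [← hv]
      · exact SimpleGraph.Adj.reachable ((SimpleGraph.fromRel_adj _ _ _).2 ⟨hv, .inl (hσ v)⟩)
    have hpow : ∀ (i : ℕ) v, H.Reachable v ((σ ^ i) v) := by
      intro i v
      induction i with
      | zero => exact SimpleGraph.Reachable.refl _
      | succ i ih => rw [pow_succ', Equiv.Perm.mul_apply]; exact ih.trans (hstep _)
    obtain ⟨i, hi⟩ := hxy.exists_nat_pow_eq
    have : C = C' := by
      rw [← h1, ← h2]
      exact SimpleGraph.ConnectedComponent.sound (hi ▸ hpow i _)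
    rw [this]

/-- A cycle cover is determined by one root on each cycle and the arcs that leave the other
vertices. -/
theorem ncard_cycleCovers_le [Fintype V] (hG : IsRegular G k) (r : ℕ) :
    {F : Set (Arc G) | IsCycleCover G F ∧ numComponents G F = r}.ncard ≤
      (Fintype.card V).choose r * k ^ (Fintype.card V - r) := by
  classical
  let out : V → Finset V := fun v => Finset.univ.filter fun w => G.Adj v w
  have hout : ∀ v, (out v).card = k := by
    intro v; rw [← (hG v).1, ← Set.ncard_coe_finset]; congr 1; ext w; simp [out]
  let T : Finset (Σ _ : Finset V, V → V) := (Finset.univ.powersetCard r).sigma fun R =>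
    Fintype.piFinset fun v => if v ∈ R then {v} else out v
  have hT : T.card = (Fintype.card V).choose r * k ^ (Fintype.card V - r) := by
    rw [Finset.card_sigma, Finset.sum_congr rfl (g := fun _ => k ^ (Fintype.card V - r))]
    · rw [Finset.sum_const, Finset.card_powersetCard, Finset.card_univ, smul_eq_mul]
    · intro R hR
      rw [Finset.mem_powersetCard] at hR
      rw [Fintype.card_piFinset]
      have : ∀ v, (if v ∈ R then {v} else out v).card = if v ∈ R then 1 else k := by
        intro v; split_ifs
        · exact Finset.card_singleton v
        · exact hout v
      simp only [this]
      rw [Finset.prod_ite, Finset.prod_const_one, one_mul, Finset.prod_const, ← hR.2,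
        ← Finset.card_compl]
      congr 2; ext; simp
  rw [← hT, ← Set.ncard_coe_finset]
  choose R hR hR' using fun F : Set (Arc G) => exists_roots (G := G) F
  have hex : ∀ F : Set (Arc G), ∃ σ : Equiv.Perm V, IsCycleCover G F →
      ∀ a : Arc G, a ∈ F ↔ σ a.tail = a.head := fun F => by
    by_cases hF : IsCycleCover G F
    · obtain ⟨σ, h⟩ := hF.exists_perm; exact ⟨σ, fun _ => h⟩
    · exact ⟨1, fun h => absurd h hF⟩
  choose σ hσ using hex
  have harc : ∀ F, IsCycleCover G F → ∀ v, ∃ a ∈ F, a.tail = v ∧ a.head = σ F v := by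
    intro F hF v
    obtain ⟨a, ⟨ha, rfl⟩, -⟩ := (hF v).1
    exact ⟨a, ha, rfl, ((hσ F hF a).1 ha).symm⟩
  refine Set.ncard_le_ncard_of_injOn
    (fun F => ⟨R F, fun v => if v ∈ R F then v else σ F v⟩) ?_ ?_ (Set.toFinite _)
  · rintro F ⟨hF, hr⟩
    simp only [T, Finset.coe_sigma, Set.mem_sigma_iff, Finset.mem_coe, Finset.mem_powersetCard,
      Fintype.mem_piFinset]
    refine ⟨⟨Finset.subset_univ _, (hR F).trans hr⟩, fun v => ?_⟩
    split_ifs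
    · exact Finset.mem_singleton_self v
    · obtain ⟨a, -, rfl, ha⟩ := harc F hF v
      simp only [out, Finset.mem_filter, Finset.mem_univ, true_and]
      rw [← ha]; exact a.2
  · rintro F ⟨hF, -⟩ F' ⟨hF', -⟩ h
    simp only [Sigma.mk.injEq, heq_eq_eq] at h
    obtain ⟨h1, h2⟩ := h
    have hσσ : σ F = σ F' := by
      refine perm_eq_of_eqOn_compl (R := (R F : Set V)) (hR' F _ (harc F hF)) ?_ ?_
      · rw [h1]; exact hR' F' _ (harc F' hF')
      · intro v hv
        have := congrFun h2 v
        rw [← h1] at this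
        simpa [Finset.mem_coe.not.1 hv] using this
    ext a
    rw [hσ F hF, hσ F' hF', hσσ]

/-! ### Some color class has few cycles -/

theorem numComponents_le_card [Fintype V] (F : Set (Arc G)) :
    numComponents G F ≤ Fintype.card V := by
  rw [← Nat.card_eq_fintype_card]
  exact Nat.card_le_card_of_surjective _ Quot.mk_surjective

/-- A cycle cover with more than `3.5 n / ln k` cycles loses a factor `k ^ r > e ^ (3.5 n)` in the
bound for the number of cycle covers with `r` cycles. -/
theorem ncard_bad_cycleCovers_le [Fintype V] (hG : IsRegular G k) (hk : 0 < k) :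
    ({F : Set (Arc G) | IsCycleCover G F ∧
      ¬ (numComponents G F : ℝ) * Real.log k ≤ 3.5 * Fintype.card V}.ncard : ℝ) ≤
      (2 * k * Real.exp (-3.5)) ^ Fintype.card V := by
  classical
  set n := Fintype.card V with hn
  let B : Finset ℕ := (Finset.range (n + 1)).filter fun r => ¬ (r : ℝ) * Real.log k ≤ 3.5 * n
  have hsub : {F : Set (Arc G) | IsCycleCover G F ∧
      ¬ (numComponents G F : ℝ) * Real.log k ≤ 3.5 * n} ⊆
      ⋃ r ∈ B, {F : Set (Arc G) | IsCycleCover G F ∧ numComponents G F = r} := by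
    rintro F ⟨hF, hr⟩
    simp only [Set.mem_iUnion]
    refine ⟨numComponents G F, ?_, hF, rfl⟩
    have := numComponents_le_card F
    simp only [B, Finset.mem_filter, Finset.mem_range]
    exact ⟨by omega, hr⟩
  have h1 : {F : Set (Arc G) | IsCycleCover G F ∧
      ¬ (numComponents G F : ℝ) * Real.log k ≤ 3.5 * n}.ncard ≤
      ∑ r ∈ B, n.choose r * k ^ (n - r) :=
    (Set.ncard_le_ncard hsub (Set.toFinite _)).trans
      ((Finset.set_ncard_biUnion_le _ _).trans
        (Finset.sum_le_sum fun r _ => ncard_cycleCovers_le hG r))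
  have hk' : (0 : ℝ) < k := by exact_mod_cast hk
  calc _ ≤ ((∑ r ∈ B, n.choose r * k ^ (n - r) : ℕ) : ℝ) := by exact_mod_cast h1
    _ = ∑ r ∈ B, (n.choose r : ℝ) * (k : ℝ) ^ (n - r) := by push_cast; rfl
    _ ≤ ∑ r ∈ B, (n.choose r : ℝ) * ((k : ℝ) ^ n * Real.exp (-3.5 * n)) := by
        refine Finset.sum_le_sum fun r hr => ?_
        simp only [B, Finset.mem_filter, Finset.mem_range, not_le] at hr
        gcongr
        have h2 : Real.exp (3.5 * n) ≤ (k : ℝ) ^ r := by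
          rw [← Real.exp_log hk', ← Real.exp_nat_mul]
          exact Real.exp_le_exp.2 hr.2.le
        have h3 : (k : ℝ) ^ (n - r) * (k : ℝ) ^ r = (k : ℝ) ^ n := by
          rw [← pow_add]; congr 1; omega
        rw [← h3, mul_assoc]
        refine le_mul_of_one_le_right (by positivity) ?_
        rw [show (-3.5 * (n : ℝ)) = -(3.5 * n) by ring, Real.exp_neg, ← div_eq_mul_inv,
          one_le_div (Real.exp_pos _)]
        exact h2
    _ ≤ ∑ r ∈ Finset.range (n + 1), (n.choose r : ℝ) * ((k : ℝ) ^ n * Real.exp (-3.5 * n)) :=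
        Finset.sum_le_sum_of_subset_of_nonneg (Finset.filter_subset _ _)
          fun _ _ _ => by positivity
    _ = (2 * k * Real.exp (-3.5)) ^ n := by
        rw [← Finset.sum_mul]
        have : (∑ r ∈ Finset.range (n + 1), (n.choose r : ℝ)) = 2 ^ n := by
          exact_mod_cast Nat.sum_range_choose n
        rw [this, mul_pow, mul_pow, ← Real.exp_nat_mul, mul_comm (n : ℝ)]
        ring

/-- With `k ^ k / k! ≤ e ^ k`, the product of the number of bad colorings and the bound for the
probability of each is at most `(2 ^ k * e ^ (-3.5 k) * e ^ (2 k)) ^ n`, and `2 ≤ e`. -/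
theorem count_mul_colorBound_le (n k : ℕ) (hk : 0 < k) :
    ((2 * k * Real.exp (-3.5)) ^ n) ^ k * colorBound n k ≤ Real.exp (-(1 / 2) * n) := by
  have hk' : (0 : ℝ) < k := by exact_mod_cast hk
  have h1 : colorBound n k ≤ ((k : ℝ) ^ k / (k.factorial : ℝ) ^ 2) ^ n := by
    rw [colorBound]
    exact div_le_self (by positivity) (one_le_pow₀ (by norm_num))
  have h2 := Real.pow_div_factorial_le_exp (k : ℝ) hk'.le k
  have h3 : (2 : ℝ) ≤ Real.exp 1 := by
    have := Real.add_one_le_exp (1 : ℝ); linarith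
  calc _ ≤ ((2 * k * Real.exp (-3.5)) ^ n) ^ k * ((k : ℝ) ^ k / (k.factorial : ℝ) ^ 2) ^ n := by
        gcongr
    _ = (2 ^ k * Real.exp (-3.5) ^ k * ((k : ℝ) ^ k / k.factorial) ^ 2) ^ n := by
        rw [← pow_mul, mul_comm n k, pow_mul, ← mul_pow]
        congr 1
        rw [mul_pow, mul_pow, div_pow]
        field_simp
    _ ≤ (Real.exp 1 ^ k * Real.exp (-3.5) ^ k * (Real.exp k) ^ 2) ^ n := by gcongr
    _ = Real.exp (-(3 / 2 : ℝ) * k + k * 1) ^ n := by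
        congr 1
        rw [← Real.exp_nat_mul, ← Real.exp_nat_mul, ← Real.exp_nat_mul, ← Real.exp_add,
          ← Real.exp_add]
        congr 1; push_cast; ring
    _ ≤ Real.exp (-(1 / 2)) ^ n := by
        gcongr
        have : (1 : ℝ) ≤ k := by exact_mod_cast hk
        linarith
    _ = _ := by rw [← Real.exp_nat_mul, mul_comm]

/-- The union bound over all colorings without a color class with few cycles. -/
theorem toOuterMeasure_bad_le [Fintype V] (hG : IsRegular G k) (hk : 0 < k)
    (p : PMF (Arc G → ℕ)) (hp : ∀ c ∈ p.support, IsCycleCoverColoring G k c)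
    (hb : ∀ c, p c ≤ ENNReal.ofReal (colorBound (Fintype.card V) k)) :
    p.toOuterMeasure {c | ¬ ∃ i ∈ Finset.Icc 1 k,
        (numComponents G (c ⁻¹' {i}) : ℝ) * Real.log k ≤ 3.5 * Fintype.card V} ≤
      ENNReal.ofReal (Real.exp (-(1 / 2) * Fintype.card V)) := by
  classical
  set n := Fintype.card V with hn
  set bad : Set (Set (Arc G)) := {F : Set (Arc G) | IsCycleCover G F ∧
    ¬ (numComponents G F : ℝ) * Real.log k ≤ 3.5 * n} with hbad
  set S : Set (Arc G → ℕ) := {c | IsCycleCoverColoring G k c ∧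
    ∀ i ∈ Finset.Icc 1 k, c ⁻¹' {i} ∈ bad} with hS
  have := Fintype.ofFinite bad
  let Φ : (Arc G → ℕ) → Fin k → Set (Arc G) := fun c i => c ⁻¹' {i.val + 1}
  have hΦ : Set.MapsTo Φ S (Fintype.piFinset fun _ : Fin k => bad.toFinset) := by
    intro c hc
    simp only [Finset.mem_coe, Fintype.mem_piFinset, Set.mem_toFinset]
    intro i
    exact hc.2 _ (Finset.mem_Icc.2 ⟨by omega, by omega⟩)
  have hinj : Set.InjOn Φ S := by
    intro c hc c' _ h
    funext a
    have ha := Finset.mem_Icc.1 (hc.1.1 a)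
    have h1 := congrFun h ⟨c a - 1, by omega⟩
    have h2 : a ∈ c ⁻¹' {c a - 1 + 1} := by simp; omega
    have h3 : a ∈ c' ⁻¹' {c a - 1 + 1} := by
      have h4 : c ⁻¹' {c a - 1 + 1} = c' ⁻¹' {c a - 1 + 1} := h1
      rwa [← h4]
    have h5 : c' a = c a - 1 + 1 := h3
    omega
  have hSfin : S.Finite := Set.Finite.of_injOn hΦ hinj (Set.toFinite _)
  have hScard : S.ncard ≤ bad.ncard ^ k := by
    refine (Set.ncard_le_ncard_of_injOn Φ hΦ hinj (Set.toFinite _)).trans ?_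
    rw [Set.ncard_coe_finset, Fintype.card_piFinset, Finset.prod_const, Finset.card_univ,
      Fintype.card_fin, ← Set.ncard_eq_toFinset_card']
  have hle : p.toOuterMeasure {c | ¬ ∃ i ∈ Finset.Icc 1 k,
      (numComponents G (c ⁻¹' {i}) : ℝ) * Real.log k ≤ 3.5 * n} ≤
      p.toOuterMeasure (hSfin.toFinset : Set (Arc G → ℕ)) := by
    apply PMF.toOuterMeasure_mono
    rintro c ⟨hc, hcs⟩
    rw [Set.Finite.coe_toFinset]
    have hcc := hp c hcs
    refine ⟨hcc, fun i hi => ⟨hcc.2 i hi, fun hle => hc ⟨i, hi, hle⟩⟩⟩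
  refine hle.trans ?_
  rw [PMF.toOuterMeasure_apply_finset]
  refine (Finset.sum_le_sum fun c _ => hb c).trans ?_
  rw [Finset.sum_const, nsmul_eq_mul, ← Set.ncard_eq_toFinset_card S hSfin,
    ← ENNReal.ofReal_natCast, ← ENNReal.ofReal_mul (by positivity)]
  apply ENNReal.ofReal_le_ofReal
  refine le_trans ?_ (count_mul_colorBound_le n k hk)
  have h1 := ncard_bad_cycleCovers_le hG hk
  have h2 := colorBound_nonneg n k
  have h3 : (S.ncard : ℝ) ≤ (bad.ncard : ℝ) ^ k := by exact_mod_cast hScard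
  exact mul_le_mul_of_nonneg_right (h3.trans (by gcongr)) h2

end Covers

/-! ### Reasoning about the machine -/

section MachineLogic

/-- The value of an expression over unbounded numbers. -/
def Expr.val (m : Mem) : Expr → ℕ
  | .lit c => c
  | .var x => m.var x
  | .get a i => m.arr a (i.val m)
  | .bin o e₁ e₂ => o.apply (e₁.val m) (e₂.val m)

/-- All the intermediate values of an expression fit into words. -/
def Expr.Fits (W : ℕ) (m : Mem) : Expr → Prop
  | .lit c => c < W
  | .var x => m.var x < W
  | .get a i => i.Fits W m ∧ m.arr a (i.val m) < W
  | .bin o e₁ e₂ => e₁.Fits W m ∧ e₂.Fits W m ∧ o.apply (e₁.val m) (e₂.val m) < W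

theorem Expr.eval_eq {W : ℕ} {m : Mem} {e : Expr} (h : e.Fits W m) :
    e.eval W m = some (e.val m) := by
  induction e with
  | lit c => exact if_pos h
  | var x => exact if_pos h
  | get a i ih => rw [Expr.eval, ih h.1, Option.bind_some]; exact if_pos h.2
  | bin o e₁ e₂ ih₁ ih₂ =>
    rw [Expr.eval, ih₁ h.1, ih₂ h.2.1, Option.bind_some, Option.bind_some]; exact if_pos h.2.2

/-- The effect of a program without loops and random assignments, over unbounded numbers. -/
def Prog.res : Prog → Mem → Mem
  | .skip, m => m
  | .assign x e, m => m.setVar x (e.val m)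
  | .store a i e, m => m.setArr a (i.val m) (e.val m)
  | .rand _ _, m => m
  | .seq p q, m => q.res (p.res m)
  | .ite e p q, m => if e.val m = 0 then q.res m else p.res m
  | .while _ _, m => m

theorem Prog.res_seq (p q : Prog) (m : Mem) : (Prog.seq p q).res m = q.res (p.res m) := rfl

/-- A program has no loops and no random assignments, and all its values fit into words. -/
def Prog.Fits (W : ℕ) : Prog → Mem → Prop
  | .skip, _ => True
  | .assign _ e, m => e.Fits W m
  | .store _ i e, m => i.Fits W m ∧ e.Fits W m
  | .rand _ _, _ => False
  | .seq p q, m => p.Fits W m ∧ q.Fits W (p.res m)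
  | .ite e p q, m => e.Fits W m ∧ if e.val m = 0 then q.Fits W m else p.Fits W m
  | .while _ _, _ => False

/-- The size of a program text, a bound for its running time if there are no loops. -/
def Prog.size : Prog → ℕ
  | .seq p q => p.size + q.size + 1
  | .ite _ p q => p.size + q.size + 1
  | _ => 1

universe u

variable {X : Type u} {W T : ℕ} {K : List Prog} {m : Mem} {f : Mem → X} {μ : PMF X}

/-- Started from `cfg`, the machine halts within `T` steps, and what `f` then reads off from the
memory has the law `μ`. -/
def Law (W T : ℕ) (cfg : Config) (f : Mem → X) (μ : PMF X) : Prop :=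
  (run W T cfg).map (fun c => (c.todo, f c.mem)) = μ.map fun x => ([], x)

/-- A program that has halted stays as it is, whatever the time left. -/
theorem law_halted : Law W T ⟨[], m⟩ f (PMF.pure (f m)) := by
  have h : run W T ⟨[], m⟩ = PMF.pure ⟨[], m⟩ := by
    induction T with
    | zero => rfl
    | succ T ih => rw [run, step, PMF.pure_bind, ih]
  rw [Law, h, PMF.pure_map, PMF.pure_map]

theorem run_succ' (W T : ℕ) (cfg : Config) : run W (T + 1) cfg = (run W T cfg).bind (step W) := by
  induction T generalizing cfg with
  | zero => simp only [run, PMF.pure_bind]; exact PMF.bind_pure _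
  | succ T ih =>
    rw [run, run, PMF.bind_bind]
    exact congrArg _ (funext ih)

theorem Law.succ {cfg : Config} (h : Law W T cfg f μ) : Law W (T + 1) cfg f μ := by
  have hsupp : ∀ c ∈ (run W T cfg).support, step W c = PMF.pure c := by
    rintro ⟨K, m⟩ hc
    have h1 : (K, f m) ∈ ((run W T cfg).map fun c => (c.todo, f c.mem)).support := by
      rw [PMF.mem_support_map_iff]; exact ⟨_, hc, rfl⟩
    rw [h, PMF.mem_support_map_iff] at h1
    obtain ⟨x, -, hx⟩ := h1
    simp only [Prod.mk.injEq] at hx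
    rw [← hx.1, step]
  have h2 : run W (T + 1) cfg = run W T cfg := by
    rw [run_succ']
    conv_rhs => rw [← PMF.bind_pure (run W T cfg)]
    ext x
    rw [PMF.bind_apply, PMF.bind_apply]
    refine tsum_congr fun c => ?_
    by_cases hc : c ∈ (run W T cfg).support
    · rw [hsupp c hc]
    · rw [(PMF.apply_eq_zero_iff _ _).2 hc, zero_mul, zero_mul]
  rw [Law, h2]; exact h

/-- A machine that has halted stays as it is, so that a bound for the time may be increased. -/
theorem Law.mono {T' : ℕ} {cfg : Config} (h : Law W T cfg f μ) (hT : T ≤ T') :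
    Law W T' cfg f μ := by
  induction hT with
  | refl => exact h
  | step _ ih => exact ih.succ

theorem law_of_step {cfg cfg' : Config} (hs : step W cfg = PMF.pure cfg')
    (h : Law W T cfg' f μ) : Law W (T + 1) cfg f μ := by
  rw [Law, run, hs, PMF.pure_bind]; exact h

theorem law_seq {p q : Prog} (h : Law W T ⟨p :: q :: K, m⟩ f μ) :
    Law W (T + 1) ⟨.seq p q :: K, m⟩ f μ := law_of_step rfl h

theorem law_ite_true {e : Expr} {p q : Prog} (he : e.Fits W m) (hv : e.val m ≠ 0)
    (h : Law W T ⟨p :: K, m⟩ f μ) : Law W (T + 1) ⟨.ite e p q :: K, m⟩ f μ := by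
  obtain ⟨v, hv'⟩ := Nat.exists_eq_succ_of_ne_zero hv
  refine law_of_step ?_ h
  rw [step, Expr.eval_eq he, hv']

theorem law_ite_false {e : Expr} {p q : Prog} (he : e.Fits W m) (hv : e.val m = 0)
    (h : Law W T ⟨q :: K, m⟩ f μ) : Law W (T + 1) ⟨.ite e p q :: K, m⟩ f μ := by
  refine law_of_step ?_ h
  rw [step, Expr.eval_eq he, hv]

theorem law_while_true {e : Expr} {p : Prog} (he : e.Fits W m) (hv : e.val m ≠ 0)
    (h : Law W T ⟨p :: .while e p :: K, m⟩ f μ) : Law W (T + 1) ⟨.while e p :: K, m⟩ f μ := by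
  obtain ⟨v, hv'⟩ := Nat.exists_eq_succ_of_ne_zero hv
  refine law_of_step ?_ h
  rw [step, Expr.eval_eq he, hv']

theorem law_while_false {e : Expr} {p : Prog} (he : e.Fits W m) (hv : e.val m = 0)
    (h : Law W T ⟨K, m⟩ f μ) : Law W (T + 1) ⟨.while e p :: K, m⟩ f μ := by
  refine law_of_step ?_ h
  rw [step, Expr.eval_eq he, hv]

theorem law_rand {x b : ℕ} {e : Expr} (he : e.Fits W m) (hv : e.val m = b + 1)
    {ν : Fin (b + 1) → PMF X} (h : ∀ r, Law W T ⟨K, m.setVar x r.val⟩ f (ν r)) :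
    Law W (T + 1) ⟨.rand x e :: K, m⟩ f ((PMF.uniformOfFintype (Fin (b + 1))).bind ν) := by
  have hs : step W ⟨.rand x e :: K, m⟩ =
      (PMF.uniformOfFintype (Fin (b + 1))).map fun r => ⟨K, m.setVar x r.val⟩ := by
    rw [step, Expr.eval_eq he, hv]
  rw [Law, run, hs, PMF.bind_map, PMF.map_bind, PMF.map_bind]
  exact congrArg _ (funext h)

/-- A program without loops and random assignments has the effect `Prog.res`, in at most
`Prog.size` steps. -/
theorem law_res {p : Prog} (hp : p.Fits W m) (h : Law W T ⟨K, p.res m⟩ f μ) :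
    Law W (T + p.size) ⟨p :: K, m⟩ f μ := by
  induction p generalizing T K m with
  | skip => exact law_of_step rfl h
  | assign x e => exact law_of_step (by rw [step, Expr.eval_eq hp]; rfl) h
  | store a i e =>
    exact law_of_step (by rw [step, Expr.eval_eq hp.1, Expr.eval_eq hp.2]; rfl) h
  | rand => exact hp.elim
  | seq p q ihp ihq =>
    rw [Prog.size, ← add_assoc, add_comm p.size, ← add_assoc]
    exact law_seq (ihp hp.1 (ihq hp.2 h))
  | ite e p q ihp ihq =>
    obtain ⟨he, hpq⟩ := hp
    rw [Prog.res] at h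
    rw [Prog.size, ← add_assoc]
    by_cases hv : e.val m = 0
    · rw [if_pos hv] at hpq h
      exact (law_ite_false he hv (ihq hpq h)).mono (by omega)
    · rw [if_neg hv] at hpq h
      exact (law_ite_true he hv (ihp hpq h)).mono (by omega)
  | _ => exact hp.elim

@[simp] theorem setVar_var (m : Mem) (x v y : ℕ) :
    (m.setVar x v).var y = if y = x then v else m.var y := by
  simp [Mem.setVar, Function.update_apply]

@[simp] theorem setVar_arr (m : Mem) (x v : ℕ) : (m.setVar x v).arr = m.arr := rfl

@[simp] theorem setArr_var (m : Mem) (a i v : ℕ) : (m.setArr a i v).var = m.var := rfl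

theorem setArr_arr_of_ne (m : Mem) {a b : ℕ} (i v : ℕ) (h : b ≠ a) :
    (m.setArr a i v).arr b = m.arr b := by
  simp [Mem.setArr, h]

@[simp] theorem setArr_arr (m : Mem) (a i v b j : ℕ) :
    (m.setArr a i v).arr b j = if b = a ∧ j = i then v else m.arr b j := by
  by_cases hb : b = a <;> by_cases hj : j = i <;> simp [Mem.setArr, hb, hj]

/-- `for j = 0, …, m - 1`: variable `4` is the counter `j` and variable `2` is the bound `m`. -/
def forArcs (body : Prog) : Prog :=
  .seq (.assign 4 (.lit 0)) (.while (.bin .lt (.var 4) (.var 2))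
    (.seq body (.assign 4 (.bin .add (.var 4) (.lit 1)))))

/-- A deterministic loop over the arcs, with an invariant `I`. -/
theorem law_forArcs {body : Prog} {M : ℕ} (hM : M + 2 ≤ W) (I : ℕ → Mem → Prop)
    (hstep : ∀ j < M, ∀ m : Mem, m.var 2 = M → m.var 4 = j → I j m →
      body.Fits W m ∧ (body.res m).var 2 = M ∧ (body.res m).var 4 = j ∧
        I (j + 1) ((body.res m).setVar 4 (j + 1)))
    (h2 : m.var 2 = M) (h0 : I 0 (m.setVar 4 0))
    (hK : ∀ m', m'.var 2 = M → I M m' → Law W T ⟨K, m'⟩ f μ) :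
    Law W (T + (M * (body.size + 3) + 3)) ⟨forArcs body :: K, m⟩ f μ := by
  have hloop : ∀ i j, i + j = M → ∀ m : Mem, m.var 2 = M → m.var 4 = j → I j m →
      Law W (T + i * (body.size + 3) + 1) ⟨.while (.bin .lt (.var 4) (.var 2))
        (.seq body (.assign 4 (.bin .add (.var 4) (.lit 1)))) :: K, m⟩ f μ := by
    intro i
    induction i with
    | zero =>
      intro j hj m h2 h4 hI
      rw [zero_add] at hj
      subst hj
      rw [zero_mul, add_zero]
      refine law_while_false ?_ ?_ (hK m h2 hI)
      · simp only [Expr.Fits, Op.apply, Expr.val, h2, h4, lt_irrefl, if_false]; omega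
      · simp [Op.apply, Expr.val, h2, h4]
    | succ i ih =>
      intro j hj m h2 h4 hI
      obtain ⟨hf, hb2, hb4, hb⟩ := hstep j (by omega) m h2 h4 hI
      have hlt : j < M := by omega
      have hres : (Prog.seq body (.assign 4 (.bin .add (.var 4) (.lit 1)))).res m =
          (body.res m).setVar 4 (j + 1) := by
        simp [Prog.res, Expr.val, Op.apply, hb4]
      have hnext := ih (j + 1) (by omega) ((body.res m).setVar 4 (j + 1)) (by simp [hb2])
        (by simp) hb
      rw [← hres] at hnext
      refine (law_while_true ?_ ?_ (law_res ?_ hnext)).mono ?_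
      · simp only [Expr.Fits, Op.apply, Expr.val, h2, h4, if_pos hlt]; omega
      · simp [Op.apply, Expr.val, h2, h4, hlt]
      · simp only [Prog.Fits, Expr.Fits, Op.apply, Expr.val, hb4]
        exact ⟨hf, by omega, by omega, by omega⟩
      · simp only [Prog.size]; rw [add_one_mul]; omega
  refine (law_seq (law_res (p := .assign 4 (.lit 0)) ?_
    (hloop M 0 rfl (m.setVar 4 0) (by simp [h2]) (by simp) h0))).mono ?_
  · simp only [Prog.Fits, Expr.Fits]; omega
  · simp only [Prog.size]; omega

end MachineLogic

/-! ### Drawing a balanced split arc by arc -/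

section DrawSplit

variable {A V : Type*}

theorem balancedSplits_comp_swap [DecidableEq A] {F : A → V} {s : A → Bool}
    (hs : s ∈ balancedSplits F) {a b : A} (hab : F a = F b) :
    s ∘ Equiv.swap a b ∈ balancedSplits F := by
  have hF : ∀ x, F (Equiv.swap a b x) = F x := by
    intro x
    rcases eq_or_ne x a with rfl | hxa
    · rw [Equiv.swap_apply_left, hab]
    rcases eq_or_ne x b with rfl | hxb
    · rw [Equiv.swap_apply_right, hab]
    rw [Equiv.swap_apply_of_ne_of_ne hxa hxb]
  intro v
  have key : ∀ e : Bool, {x | F x = v ∧ (s ∘ Equiv.swap a b) x = e}.ncard =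
      {x | F x = v ∧ s x = e}.ncard := by
    intro e
    rw [← Set.ncard_image_of_injective _ (Equiv.swap a b).injective]
    congr 1
    ext x
    simp only [Set.mem_image, Set.mem_ofPred_eq, Function.comp_apply]
    constructor
    · rintro ⟨y, ⟨h1, h2⟩, rfl⟩; exact ⟨by rw [hF, h1], h2⟩
    · rintro ⟨h1, h2⟩
      exact ⟨Equiv.swap a b x, ⟨by rw [hF, h1], by rw [Equiv.swap_apply_self, h2]⟩,
        Equiv.swap_apply_self _ _ _⟩
  rw [key, key]; exact hs v

/-- Among the balanced splits with prescribed values on `P`, the fraction of those that put the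
next arc `a₀` into the first copy is the number of free places there divided by the number of all
free places.  Double counting: exchanging `a₀` with a later arc of the opposite value. -/
theorem ncard_balancedSplits_extension [Finite A] {F : A → V} {s : A → Bool} {P : Set A}
    {a₀ : A} (ha₀ : a₀ ∉ P) {q₀ q₁ : ℕ} {C : Set (A → Bool)}
    (hC : C = {s' | s' ∈ balancedSplits F ∧ ∀ a ∈ P, s' a = s a})
    (h0 : ∀ s' ∈ C, {a | a ∉ P ∧ F a = F a₀ ∧ s' a = false}.ncard = q₀)
    (h1 : ∀ s' ∈ C, {a | a ∉ P ∧ F a = F a₀ ∧ s' a = true}.ncard = q₁) :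
    {s' ∈ C | s' a₀ = false}.ncard * (q₀ + q₁) = q₀ * C.ncard := by
  classical
  have := Fintype.ofFinite A
  let C0 : Finset (A → Bool) := Finset.univ.filter fun s' => s' ∈ C ∧ s' a₀ = false
  let C1 : Finset (A → Bool) := Finset.univ.filter fun s' => s' ∈ C ∧ s' a₀ = true
  let N : Bool → (A → Bool) → Finset A := fun e s' =>
    Finset.univ.filter fun a => a ∉ P ∧ F a = F a₀ ∧ s' a = e
  have hN0 : ∀ s' ∈ C, (N false s').card = q₀ := by
    intro s' hs'; rw [← h0 s' hs', ← Set.ncard_coe_finset]; congr 1; ext a; simp [N]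
  have hN1 : ∀ s' ∈ C, (N true s').card = q₁ := by
    intro s' hs'; rw [← h1 s' hs', ← Set.ncard_coe_finset]; congr 1; ext a; simp [N]
  have hswap : ∀ s' ∈ C, ∀ a, a ∉ P → F a = F a₀ → s' ∘ Equiv.swap a₀ a ∈ C := by
    intro s' hs' a haP haF
    rw [hC] at hs' ⊢
    refine ⟨balancedSplits_comp_swap hs'.1 haF.symm, fun x hx => ?_⟩
    rw [Function.comp_apply, Equiv.swap_apply_of_ne_of_ne, hs'.2 x hx]
    · rintro rfl; exact ha₀ hx
    · rintro rfl; exact haP hx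
  have hdc : (C0.sigma (N true)).card = (C1.sigma (N false)).card := by
    refine Finset.card_nbij' (fun x => ⟨x.1 ∘ Equiv.swap a₀ x.2, x.2⟩)
      (fun x => ⟨x.1 ∘ Equiv.swap a₀ x.2, x.2⟩) ?_ ?_ ?_ ?_
    · rintro ⟨s', a⟩ h
      simp only [C0, C1, N, Finset.coe_sigma, Set.mem_sigma_iff, Finset.mem_coe,
        Finset.mem_filter, Finset.mem_univ, true_and] at h ⊢
      obtain ⟨⟨h1, h2⟩, h3, h4, h5⟩ := h
      exact ⟨⟨hswap s' h1 a h3 h4, by simp [h5]⟩, h3, h4, by simp [h2]⟩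
    · rintro ⟨s', a⟩ h
      simp only [C0, C1, N, Finset.coe_sigma, Set.mem_sigma_iff, Finset.mem_coe,
        Finset.mem_filter, Finset.mem_univ, true_and] at h ⊢
      obtain ⟨⟨h1, h2⟩, h3, h4, h5⟩ := h
      exact ⟨⟨hswap s' h1 a h3 h4, by simp [h5]⟩, h3, h4, by simp [h2]⟩
    · rintro ⟨s', a⟩ _
      simp only [Sigma.mk.injEq, heq_eq_eq, and_true]
      funext x; simp
    · rintro ⟨s', a⟩ _
      simp only [Sigma.mk.injEq, heq_eq_eq, and_true]
      funext x; simp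
  rw [Finset.card_sigma, Finset.card_sigma,
    Finset.sum_congr rfl (g := fun _ => q₁)
      (fun s' hs' => hN1 s' (Finset.mem_filter.1 hs').2.1),
    Finset.sum_congr rfl (g := fun _ => q₀)
      (fun s' hs' => hN0 s' (Finset.mem_filter.1 hs').2.1),
    Finset.sum_const, Finset.sum_const, smul_eq_mul, smul_eq_mul] at hdc
  have e0 : {s' ∈ C | s' a₀ = false}.ncard = C0.card := by
    rw [← Set.ncard_coe_finset]; congr 1; ext s'; simp [C0]
  have e1 : C.ncard = C0.card + C1.card := by
    rw [← Finset.card_union_of_disjoint, ← Set.ncard_coe_finset]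
    · congr 1; ext s'; cases h : s' a₀ <;> simp [C0, C1, h]
    · rw [Finset.disjoint_left]; intro s' h h'
      simp only [C0, C1, Finset.mem_filter] at h h'
      simp [h.2.2] at h'
  rw [e0, e1]
  nlinarith

end DrawSplit

/-- Puts the current arc into the copy `0` of its end if the random number in variable `6` is less
than the number of free places there, and into the copy `1` otherwise. -/
def placeArc (α : ℕ) : Prog :=
  .seq (.assign 5 (.bin .add (.var 5) (.bin .sub (.lit 1) (.bin .lt (.var 6) (.get 3 (.var 5))))))
    <| .seq (.store 3 (.var 5) (.bin .sub (.get 3 (.var 5)) (.lit 1)))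
    <| .seq (.store α (.var 4) (.var 5))
    <| .assign 4 (.bin .add (.var 4) (.lit 1))

/-- The treatment of one arc, and the loop over all arcs. -/
def splitLoop (α : ℕ) : Prog :=
  .while (.bin .lt (.var 4) (.var 2)) <|
    .seq (.assign 5 (.bin .mul (.lit 2) (.get α (.var 4)))) <|
    .seq (.rand 6 (.bin .add (.get 3 (.var 5)) (.get 3 (.bin .add (.var 5) (.lit 1))))) <|
    placeArc α

/-- Splits the ends of the arcs listed in the array `α` (`0` for tails, `1` for heads), where
variable `3` holds the number of arcs that each copy gets.  Entry `2 * v + b` of array `3` is the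
number of free places at the copy `b` of the vertex `v`. -/
def splitProg (α : ℕ) : Prog :=
  .seq (forArcs (.store 3 (.var 4) (.var 3))) <| .seq (.assign 4 (.lit 0)) <| splitLoop α

section SplitLaw

universe u

variable {A V X : Type u} {M W k N : ℕ} {e : A ≃ Fin M} {num : V → ℕ} {F : A → V} {α : ℕ}
  {K : List Prog} {f : Mem → X}

/-- The memory after the first `j` arcs have been distributed according to `s`. -/
structure SplitInv (e : A ≃ Fin M) (num : V → ℕ) (F : A → V) (k α : ℕ) (m₀ : Mem) (j : ℕ)
    (s : A → Bool) (m : Mem) : Prop where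
  var : ∀ x < 4, m.var x = m₀.var x
  counter : m.var 4 = j
  arr : ∀ β, β ≠ α → β ≠ 3 → m.arr β = m₀.arr β
  ends : ∀ a, m.arr α (e a) = if (e a).val < j then 2 * num (F a) + (s a).toNat else num (F a)
  free : ∀ v b, m.arr 3 (2 * num v + b.toNat) +
    {a | (e a).val < j ∧ F a = v ∧ s a = b}.ncard = k

/-- From any reachable point of the loop on, the split that is finally produced is uniform among the
balanced splits that agree with the choices made so far.  The bound counts `13` steps for each of
the `i` remaining arcs. -/
theorem law_splitLoop [Finite A] [Finite V] (hα : α ≠ 3) (hnum : Function.Injective num)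
    (hN : ∀ v, num v < N) (hNM : 2 * N ≤ M) (hkM : k ≤ M) (hW : 4 * (M + 2) ≤ W)
    (hF : RegularMap F (2 * k)) {m₀ : Mem} (h2 : m₀.var 2 = M) {T : ℕ}
    {μ : (A → Bool) → PMF X}
    (hK : ∀ s ∈ balancedSplits F, ∀ m', (∀ x < 4, m'.var x = m₀.var x) →
      (∀ β, β ≠ α → β ≠ 3 → m'.arr β = m₀.arr β) →
      (∀ a, m'.arr α (e a) = 2 * num (F a) + (s a).toNat) → Law W T ⟨K, m'⟩ f (μ s))
    (i j : ℕ) (hij : i + j = M) (s : A → Bool) (m : Mem)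
    (hI : SplitInv e num F k α m₀ j s m)
    (hne : {s' | s' ∈ balancedSplits F ∧ ∀ a ∈ {a | (e a).val < j}, s' a = s a}.Nonempty) :
    Law W (T + i * 13 + 1) ⟨splitLoop α :: K, m⟩ f
      ((uniformOn {s' | s' ∈ balancedSplits F ∧ ∀ a ∈ {a | (e a).val < j}, s' a = s a}).bind
        μ) := by
  classical
  induction i generalizing j s m with
  | zero =>
    have hj : j = M := by omega
    subst hj
    have hset : {s' | s' ∈ balancedSplits F ∧ ∀ a ∈ {a | (e a).val < j}, s' a = s a} = {s} := by
      obtain ⟨s', hs', h⟩ := hne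
      have hss : s' = s := funext fun a => h a (e a).2
      ext s''
      constructor
      · rintro ⟨-, h''⟩; exact funext fun a => h'' a (e a).2
      · rintro rfl; exact ⟨hss ▸ hs', fun _ _ => rfl⟩
    have hs : s ∈ balancedSplits F := by
      have : s ∈ ({s} : Set (A → Bool)) := rfl
      rw [← hset] at this; exact this.1
    rw [hset, uniformOn_singleton, PMF.pure_bind, zero_mul, add_zero]
    have hv2 : m.var 2 = j := by rw [hI.var 2 (by omega), h2]
    refine law_while_false ?_ ?_ (hK s hs m hI.var hI.arr ?_)
    · simp only [Expr.Fits, Op.apply, Expr.val, hv2, hI.counter, lt_irrefl, if_false]; omega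
    · simp [Op.apply, Expr.val, hv2, hI.counter]
    · intro a; rw [hI.ends, if_pos (e a).2]
  | succ i ih =>
    have hjM : j < M := by omega
    have hv2 : m.var 2 = M := by rw [hI.var 2 (by omega), h2]
    set a₀ : A := e.symm ⟨j, hjM⟩ with ha₀
    have hea₀ : (e a₀).val = j := by rw [ha₀, Equiv.apply_symm_apply]
    set v := F a₀ with hv
    have hea : ∀ a, (e a).val = j ↔ a = a₀ := by
      intro a
      rw [← hea₀, Fin.val_inj, e.injective.eq_iff]
    set P : Set A := {a | (e a).val < j} with hP
    set C : Set (A → Bool) := {s' | s' ∈ balancedSplits F ∧ ∀ a ∈ P, s' a = s a} with hC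
    set q₀ := m.arr 3 (2 * num v) with hq₀
    set q₁ := m.arr 3 (2 * num v + 1) with hq₁
    have ha₀P : a₀ ∉ P := by simp [hP, hea₀]
    -- the numbers of free places are determined by the prefix
    have hcount : ∀ s' ∈ C, ∀ b : Bool, {a | a ∉ P ∧ F a = v ∧ s' a = b}.ncard =
        m.arr 3 (2 * num v + b.toNat) := by
      intro s' hs' b
      have h1 := ncard_of_mem_balancedSplits hF hs'.1 v b
      have h2 := hI.free v b
      have h3 : {a | F a = v ∧ s' a = b}.ncard = {a | (e a).val < j ∧ F a = v ∧ s a = b}.ncard +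
          {a | a ∉ P ∧ F a = v ∧ s' a = b}.ncard := by
        rw [← Set.ncard_union_eq _ (Set.toFinite _) (Set.toFinite _)]
        · congr 1; ext a
          simp only [Set.mem_union, Set.mem_ofPred_eq]
          by_cases ha : a ∈ P
          · have := hs'.2 a ha
            have ha' : (e a).val < j := ha
            simp [ha, ha', this]
          · have ha' : ¬ (e a).val < j := ha
            simp [ha, ha']
        · rw [Set.disjoint_left]; rintro a ⟨h, -⟩ ⟨h', -⟩; exact h' h
      omega
    have hcard : {s' ∈ C | s' a₀ = false}.ncard * (q₀ + q₁) = q₀ * C.ncard :=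
      ncard_balancedSplits_extension ha₀P hC (fun s' hs' => by simpa using hcount s' hs' false)
        (fun s' hs' => by simpa using hcount s' hs' true)
    have hqpos : 0 < q₀ + q₁ := by
      obtain ⟨s', hs'⟩ := hne
      have h1 := hcount s' hs' (s' a₀)
      have h2 : 0 < {a | a ∉ P ∧ F a = v ∧ s' a = s' a₀}.ncard :=
        (Set.ncard_pos (Set.toFinite _)).2 ⟨a₀, ha₀P, rfl, rfl⟩
      cases hs0 : s' a₀ <;> simp only [hs0, Bool.toNat_false, Bool.toNat_true, add_zero] at h1 h2 <;> omega
    obtain ⟨b, hb⟩ := Nat.exists_eq_add_of_lt hqpos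
    rw [zero_add] at hb
    rw [hb] at hcard
    have hCpos : 0 < C.ncard := (Set.ncard_pos (Set.toFinite _)).2 hne
    have hq₀k : q₀ ≤ k := by have := hI.free v false; simp only [Bool.toNat_false, add_zero] at this; omega
    have hq₁k : q₁ ≤ k := by have := hI.free v true; simp only [Bool.toNat_true] at this; omega
    have hsplit : C.ncard = {s' ∈ C | s' a₀ = false}.ncard + {s' ∈ C | ¬ s' a₀ = false}.ncard := by
      rw [← Set.ncard_union_eq _ (Set.toFinite _) (Set.toFinite _)]
      · congr 1; ext x; simp only [Set.mem_union, Set.mem_ofPred_eq]; tauto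
      · rw [Set.disjoint_left]; rintro x ⟨_, h⟩ ⟨_, h'⟩; exact h' h
    -- the memory after the arc `a₀` has been put into the copy `b'`
    have hnext : ∀ b' : Bool, 0 < m.arr 3 (2 * num v + b'.toNat) →
        {s' ∈ C | s' a₀ = b'}.Nonempty → ∀ r : ℕ, r < M + M + 2 →
        (b'.toNat = 1 - if r < q₀ then 1 else 0) →
        Law W (T + i * 13 + 1 + 7) ⟨placeArc α :: splitLoop α :: K,
          (m.setVar 5 (2 * num v)).setVar 6 r⟩ f ((uniformOn {s' ∈ C | s' a₀ = b'}).bind μ) := by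
      intro b' hpos hne' r hr hbr
      have hw : m.arr 3 (2 * num v + b'.toNat) ≤ k := by have := hI.free v b'; omega
      have hnv := hN v
      have hb1 : b'.toNat ≤ 1 := Bool.toNat_le b'
      have hset : {s' ∈ C | s' a₀ = b'} = {s' | s' ∈ balancedSplits F ∧
          ∀ a ∈ {a | (e a).val < j + 1}, s' a = Function.update s a₀ b' a} := by
        ext s'
        simp only [hC, hP, Set.mem_ofPred_eq, and_assoc]
        refine and_congr_right fun _ => ⟨fun h a ha => ?_, fun h => ⟨fun a ha => ?_, ?_⟩⟩
        · by_cases haa : a = a₀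
          · rw [haa, Function.update_self, h.2]
          · rw [Function.update_of_ne haa]
            exact h.1 a (by have := (hea a).not.2 haa; omega)
        · have haa : a ≠ a₀ := by rintro rfl; omega
          rw [h a (by omega), Function.update_of_ne haa]
        · rw [h a₀ (by omega), Function.update_self]
      have hres : (placeArc α).res ((m.setVar 5 (2 * num v)).setVar 6 r) =
          (((((m.setVar 5 (2 * num v)).setVar 6 r).setVar 5 (2 * num v + b'.toNat)).setArr 3
            (2 * num v + b'.toNat) (m.arr 3 (2 * num v + b'.toNat) - 1)).setArr α j
            (2 * num v + b'.toNat)).setVar 4 (j + 1) := by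
        simp [placeArc, Prog.res, Expr.val, Op.apply, hI.counter, hbr, ← hq₀]
      rw [hset] at hne' ⊢
      have hsize : (placeArc α).size = 7 := rfl
      rw [← hsize]
      refine law_res ?_ (ih (j + 1) (by omega) (Function.update s a₀ b') _ ?_ hne')
      · simp [placeArc, Prog.Fits, Prog.res, Expr.Fits, Expr.val, Op.apply, hI.counter, ← hq₀,
          ← hbr]
        have hif : (if r < q₀ then 1 else 0) ≤ 1 := by split_ifs <;> omega
        omega
      · rw [hres]
        have hne3 : (3 : ℕ) ≠ α := fun h => hα h.symm
        refine ⟨fun x hx => ?_, by simp, fun β h1 h3 => ?_, fun a => ?_, fun u c => ?_⟩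
        · have := hI.var x hx
          simp only [setVar_var, setArr_var]
          rw [if_neg (by omega), if_neg (by omega), if_neg (by omega), if_neg (by omega), this]
        · rw [setVar_arr, setArr_arr_of_ne _ _ _ h1, setArr_arr_of_ne _ _ _ h3]
          exact hI.arr β h1 h3
        · rw [setVar_arr, setArr_arr]
          by_cases haa : a = a₀
          · rw [if_pos ⟨rfl, by rw [haa, hea₀]⟩, if_pos (by rw [haa, hea₀]; omega), haa,
              Function.update_self]
          · have hne := (hea a).not.2 haa
            rw [if_neg (fun h => hne h.2), setArr_arr_of_ne _ _ _ hα, Function.update_of_ne haa,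
              setVar_arr, setVar_arr, setVar_arr, hI.ends]
            by_cases hlt : (e a).val < j
            · rw [if_pos hlt, if_pos (by omega)]
            · rw [if_neg hlt, if_neg (by omega)]
        · have h1 := hI.free u c
          rw [setVar_arr, setArr_arr_of_ne _ _ _ hne3, setArr_arr]
          simp only [setVar_arr, true_and]
          have hinj : 2 * num u + c.toNat = 2 * num v + b'.toNat ↔ u = v ∧ c = b' := by
            constructor
            · intro h
              have hc1 : c.toNat ≤ 1 := Bool.toNat_le c
              exact ⟨hnum (by omega), by revert h; cases c <;> cases b' <;> simp <;> omega⟩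
            · rintro ⟨rfl, rfl⟩; rfl
          simp only [hinj]
          by_cases huv : u = v ∧ c = b'
          · obtain ⟨rfl, rfl⟩ := huv
            rw [if_pos ⟨rfl, rfl⟩]
            have hins : {a | (e a).val < j + 1 ∧ F a = v ∧ Function.update s a₀ c a = c} =
                insert a₀ {a | (e a).val < j ∧ F a = v ∧ s a = c} := by
              ext a
              simp only [Set.mem_insert_iff, Set.mem_ofPred_eq]
              by_cases haa : a = a₀
              · simp [haa, hea₀, ← hv]
              · have hne := (hea a).not.2 haa
                rw [Function.update_of_ne haa]
                simp only [haa, false_or]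
                exact and_congr_left fun _ => by omega
            rw [hins, Set.ncard_insert_of_notMem (by simp [hea₀]) (Set.toFinite _)]
            omega
          · rw [if_neg huv, ← h1]
            congr 2
            ext a
            simp only [Set.mem_ofPred_eq]
            by_cases haa : a = a₀
            · subst haa
              simp only [Function.update_self, hea₀, lt_irrefl, false_and, iff_false]
              rintro ⟨-, h, h'⟩
              exact huv ⟨h.symm, h'.symm⟩
            · have hne := (hea a).not.2 haa
              rw [Function.update_of_ne haa]
              exact and_congr_left fun _ => by omega
    have hlt : m.var 4 < m.var 2 := by rw [hv2, hI.counter]; exact hjM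
    have hαj : m.arr α j = num v := by
      have := hI.ends a₀
      rw [hea₀, if_neg (lt_irrefl j)] at this
      exact this
    have hnv := hN v
    rw [uniformOn_eq_bind hne (fun s' => s' a₀ = false) hcard, PMF.bind_bind]
    refine (law_while_true ?_ ?_ (law_seq (law_res ?_ (law_seq (law_rand ?_ ?_ (fun r => ?_)
      (T := T + i * 13 + 1 + 7)))))).mono ?_
    · simp only [Expr.Fits, Op.apply, Expr.val, hv2, hI.counter, if_pos hjM]; omega
    · simp [Op.apply, Expr.val, hlt]
    · simp only [Prog.Fits, Expr.Fits, Op.apply, Expr.val, hI.counter, hαj]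
      omega
    · simp [Prog.res, Expr.Fits, Op.apply, Expr.val, hI.counter, hαj, ← hq₀, ← hq₁]
      omega
    · simp [Prog.res, Op.apply, Expr.val, hI.counter, hαj, ← hq₀, ← hq₁, hb]
    · have hres : (Prog.assign 5 (.bin .mul (.lit 2) (.get α (.var 4)))).res m =
          m.setVar 5 (2 * num v) := by
        simp [Prog.res, Expr.val, Op.apply, hI.counter, hαj]
      rw [hres]
      have hr := r.2
      by_cases hrq : r.val < q₀
      · rw [if_pos hrq]
        refine hnext false (by simp only [Bool.toNat_false, add_zero]; omega) ?_ r (by omega)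
          (by simp [hrq])
        refine (Set.ncard_pos (Set.toFinite _)).1 (Nat.pos_of_ne_zero fun h0 => ?_)
        rw [h0, zero_mul] at hcard
        rcases Nat.mul_eq_zero.1 hcard.symm with h | h <;> omega
      · rw [if_neg hrq]
        have heq : {s' ∈ C | ¬ s' a₀ = false} = {s' ∈ C | s' a₀ = true} := by
          ext s'; simp
        rw [heq] at hsplit ⊢
        refine hnext true (by simp only [Bool.toNat_true]; omega) ?_ r (by omega)
          (by simp [hrq])
        refine (Set.ncard_pos (Set.toFinite _)).1 (Nat.pos_of_ne_zero fun h0 => ?_)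
        rw [h0, add_zero] at hsplit
        rw [← hsplit, mul_comm] at hcard
        have := Nat.eq_of_mul_eq_mul_right hCpos hcard
        omega
    · simp only [Prog.size]; rw [add_one_mul]; omega

/-- The program `splitProg α` draws a uniform balanced split, and replaces the number of the end of
each arc by the number of its copy. -/
theorem law_splitProg [Finite A] [Finite V] (hα : α ≠ 3) (hnum : Function.Injective num)
    (hN : ∀ v, num v < N) (hNM : 2 * N ≤ M) (hkM : k ≤ M) (hW : 4 * (M + 2) ≤ W)
    (hF : RegularMap F (2 * k)) {m₀ : Mem} (h2 : m₀.var 2 = M) (h3 : m₀.var 3 = k)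
    (hends : ∀ a, m₀.arr α (e a) = num (F a)) {T : ℕ} {μ : (A → Bool) → PMF X}
    (hK : ∀ s ∈ balancedSplits F, ∀ m', (∀ x < 4, m'.var x = m₀.var x) →
      (∀ β, β ≠ α → β ≠ 3 → m'.arr β = m₀.arr β) →
      (∀ a, m'.arr α (e a) = 2 * num (F a) + (s a).toNat) → Law W T ⟨K, m'⟩ f (μ s)) :
    Law W (T + (M * 17 + 8)) ⟨splitProg α :: K, m₀⟩ f
      ((uniformOn (balancedSplits F)).bind μ) := by
  let I : ℕ → Mem → Prop := fun j m => (∀ x < 4, m.var x = m₀.var x) ∧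
    (∀ β, β ≠ 3 → m.arr β = m₀.arr β) ∧ ∀ i < j, m.arr 3 i = k
  have hmain : ∀ m, m.var 2 = M → I M m →
      Law W (T + M * 13 + 1 + 1 + 1) ⟨.seq (.assign 4 (.lit 0)) (splitLoop α) :: K, m⟩ f
        ((uniformOn (balancedSplits F)).bind μ) := by
    intro m hm hI
    refine law_seq (law_res (p := .assign 4 (.lit 0)) ?_ ?_)
    · simp only [Prog.Fits, Expr.Fits]; omega
    · have hset : balancedSplits F = {s' | s' ∈ balancedSplits F ∧
          ∀ a ∈ {a | (e a).val < 0}, s' a = (fun _ => false : A → Bool) a} := by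
        ext s'; simp
      have hne := balancedSplits_nonempty hF
      rw [hset] at hne ⊢
      refine law_splitLoop hα hnum hN hNM hkM hW hF h2 hK M 0 rfl (fun _ => false) _ ?_ hne
      refine ⟨fun x hx => ?_, by simp [Prog.res, Expr.val], fun β _ hβ => hI.2.1 β hβ,
        fun a => ?_, fun v b => ?_⟩
      · simp only [Prog.res, setVar_var]
        rw [if_neg (by omega)]; exact hI.1 x hx
      · rw [if_neg (by omega), ← hends a, ← hI.2.1 α hα]; rfl
      · have := hN v
        have := Bool.toNat_le b
        have h := hI.2.2 (2 * num v + b.toNat) (by omega)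
        simpa [Prog.res] using h
  refine (law_seq (law_forArcs (by omega) I ?_ h2 ?_ hmain)).mono ?_
  · intro j hj m hm2 hm4 hI
    have hm3 : m.var 3 = k := by rw [hI.1 3 (by omega), h3]
    refine ⟨?_, hm2, hm4, fun x hx => ?_, fun β hβ => ?_, fun i hi => ?_⟩
    · simp only [Prog.Fits, Expr.Fits]; omega
    · simp only [Prog.res, setVar_var, setArr_var]
      rw [if_neg (by omega)]; exact hI.1 x hx
    · simp only [Prog.res, setVar_arr]
      rw [setArr_arr_of_ne _ _ _ hβ]; exact hI.2.1 β hβ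
    · simp only [Prog.res, setVar_arr, setArr_arr, Expr.val, hm3, hm4, true_and]
      split_ifs with h
      · rfl
      · exact hI.2.2 i (by omega)
  · refine ⟨fun x hx => ?_, fun β _ => rfl, fun i hi => by omega⟩
    simp only [setVar_var]; rw [if_neg (by omega)]
  · simp only [Prog.size]; omega

end SplitLaw

/-! ### Drawing an alternating division tour by tour -/

section Tours

variable {A : Type*} {M : ℕ} {τ η : A → A} {e : A ≃ Fin M} {U : Set A} {D : A → Bool}

/-- The alternating functions that agree with `D` on the set `U` of visited arcs and, if the arc
number `x` is not visited, have the value `b` there. -/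
def walkSet (τ η : A → A) (e : A ≃ Fin M) (U : Set A) (D : A → Bool) (x : ℕ) (b : Bool) :
    Set (A → Bool) :=
  {s | (∀ a, s (τ a) = !s a ∧ s (η a) = !s a) ∧ (∀ u ∈ U, s u = D u) ∧
    ∀ a, a ∉ U → (e a).val = x → s a = b}

/-- The shape of the set `U` of visited arcs when all arcs before number `j` have been visited and
the walk stands at the arc number `x`: either `x = j` and `U` consists of whole tours, or the tour
of the arc number `j` has been followed to `x`, so that its two loose ends are that arc and the
arc before `x`. -/
structure WalkState (τ η : A → A) (e : A ≃ Fin M) (U : Set A) (j x : ℕ) : Prop where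
  tau : ∀ u ∈ U, τ u ∈ U
  below : ∀ a, (e a).val < j → a ∈ U
  pos : (x = j ∧ ∀ u ∈ U, η u ∈ U) ∨ ∃ y a₀, (e y).val = x ∧ (e a₀).val = j ∧ y ∉ U ∧ η y ∈ U ∧
    a₀ ∈ U ∧ ∀ u ∈ U, η u ∈ U ∨ u = a₀ ∨ u = η y

/-- Marking the arc `y` and its partner moves the loose end to the next arc of the tour, which is
either not yet visited or the first arc of the tour, in which case the tour is closed. -/
theorem WalkState.mark {j : ℕ} (hτ : ∀ a, τ (τ a) = a) (hη : ∀ a, η (η a) = a)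
    (hτ' : ∀ a, τ a ≠ a) (hη' : ∀ a, η a ≠ a) {y : A} (hy : y ∉ U) (hj : j < M)
    (h : WalkState τ η e U j (e y)) :
    WalkState τ η e (insert y (insert (τ y) U)) j (e (η (τ y))) := by
  have heinj : ∀ a b : A, (e a).val = (e b).val → a = b := fun a b hab =>
    e.injective (Fin.ext hab)
  have hτy : τ y ∉ U := fun hm => hy (hτ y ▸ h.tau _ hm)
  have hmem : ∀ u, u ∈ insert y (insert (τ y) U) ↔ u = y ∨ u = τ y ∨ u ∈ U := fun u => by
    simp only [Set.mem_insert_iff]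
  refine ⟨fun u hu => ?_, fun a ha => ?_, ?_⟩
  · rw [hmem] at hu ⊢
    rcases hu with rfl | rfl | hu
    · exact .inr (.inl rfl)
    · exact .inl (hτ y)
    · exact .inr (.inr (h.tau u hu))
  · rw [hmem]; exact .inr (.inr (h.below a ha))
  · set z := η (τ y) with hz
    have hηz : η z = τ y := hη _
    obtain ⟨a₀, ha₀⟩ : ∃ a₀ : A, (e a₀).val = j := ⟨e.symm ⟨j, hj⟩, by simp⟩
    -- in both cases, the loose ends before this step are `a₀` and the arc before `y`
    have hU : (y = a₀ ∨ a₀ ∈ U) ∧ (y = a₀ ∨ η y ∈ U) ∧ ∀ u ∈ U, η u ∈ U ∨ u = a₀ ∨ u = η y := by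
      rcases h.pos with ⟨h1, h2⟩ | ⟨y', a', h1, h2, -, h3, h4, h5⟩
      · exact ⟨.inl (heinj _ _ (h1.trans ha₀.symm)), .inl (heinj _ _ (h1.trans ha₀.symm)),
          fun u hu => .inl (h2 u hu)⟩
      · obtain rfl := heinj _ _ h1
        obtain rfl := heinj _ _ (h2.trans ha₀.symm)
        exact ⟨.inr h4, .inr h3, h5⟩
    obtain ⟨hU1, hU2, hU3⟩ := hU
    simp only [hmem]
    by_cases hza : z = a₀
    · refine .inl ⟨by rw [hza, ha₀], ?_⟩
      rintro u (rfl | rfl | hu)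
      · rcases hU2 with h1 | h1
        · refine .inr (.inl ?_)
          conv_lhs => rw [h1, ← hza, hηz]
        · exact .inr (.inr h1)
      · rw [← hz, hza]
        rcases hU1 with h1 | h1
        · exact .inl h1.symm
        · exact .inr (.inr h1)
      · rcases hU3 u hu with h1 | h1 | h1
        · exact .inr (.inr h1)
        · rw [h1, ← hza, hηz]; exact .inr (.inl rfl)
        · rw [h1, hη]; exact .inl rfl
    · refine .inr ⟨z, a₀, rfl, ha₀, ?_, ?_, ?_, ?_⟩
      · rintro (h1 | h1 | h1)
        · rcases hU2 with h2 | h2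
          · exact hza (h1.trans h2)
          · rw [← h1, hηz] at h2; exact hτy h2
        · exact hη' (τ y) h1
        · rcases hU3 z h1 with h2 | h2 | h2
          · rw [hηz] at h2; exact hτy h2
          · exact hza h2
          · have := congrArg η h2
            rw [hηz, hη] at this
            exact hτ' y this
      · rw [hηz]; exact .inr (.inl rfl)
      · rcases hU1 with h1 | h1
        · exact .inl h1.symm
        · exact .inr (.inr h1)
      · rw [hηz]
        rintro u (rfl | rfl | hu)
        · rcases hU2 with h1 | h1
          · exact .inr (.inl h1)
          · exact .inl (.inr (.inr h1))
        · exact .inr (.inr rfl)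
        · rcases hU3 u hu with h1 | h1 | h1
          · exact .inl (.inr (.inr h1))
          · exact .inr (.inl h1)
          · rw [h1, hη]; exact .inl (.inl rfl)

/-- The value at an arc determines the values at its partner and at the next arc of the tour. -/
theorem walkSet_mark [DecidableEq A] (hτ : ∀ a, τ (τ a) = a) (htau : ∀ u ∈ U, τ u ∈ U)
    (hτ' : ∀ a, τ a ≠ a) {y : A} (hy : y ∉ U) (b : Bool) :
    walkSet τ η e U D (e y) b = walkSet τ η e (insert y (insert (τ y) U))
      (fun a => if a = y then b else if a = τ y then !b else D a) (e (η (τ y))) b := by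
  have heinj : ∀ a b : A, (e a).val = (e b).val → a = b := fun a b hab =>
    e.injective (Fin.ext hab)
  have hτy : τ y ∉ U := fun hm => hy (hτ y ▸ htau _ hm)
  ext s
  refine and_congr_right fun hs => ⟨fun ⟨h1, h2⟩ => ?_, fun ⟨h1, _⟩ => ?_⟩
  · have hsy := h2 y hy rfl
    refine ⟨?_, fun a _ ha => ?_⟩
    · rintro u (rfl | rfl | hu) <;> beta_reduce
      · rw [if_pos rfl, hsy]
      · rw [if_neg (hτ' y), if_pos rfl, (hs y).1, hsy]
      · rw [if_neg (fun h : u = y => hy (h ▸ hu)), if_neg (fun h : u = τ y => hτy (h ▸ hu)),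
          h1 u hu]
    · rw [heinj _ _ ha, (hs _).2, (hs _).1, Bool.not_not, hsy]
  · refine ⟨fun u hu => ?_, fun a _ ha => ?_⟩
    · refine (h1 u (.inr (.inr hu))).trans ?_
      beta_reduce
      rw [if_neg (fun h : u = y => hy (h ▸ hu)), if_neg (fun h : u = τ y => hτy (h ▸ hu))]
    · rw [heinj _ _ ha]
      exact (h1 y (.inl rfl)).trans (if_pos rfl)

/-- When `U` consists of whole tours, exchanging the parts outside `U` shows that the value at the
next unvisited arc is a fair coin.  If the arc number `x` is visited, or does not exist, then the
coin has no effect. -/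
theorem uniformOn_walkSet_coin [Finite A] (htau : ∀ u ∈ U, τ u ∈ U) (heta : ∀ u ∈ U, η u ∈ U)
    (hτ : ∀ a, τ (τ a) = a) (hη : ∀ a, η (η a) = a) (x : ℕ) {C : Set (A → Bool)}
    (hC : C = {s | (∀ a, s (τ a) = !s a ∧ s (η a) = !s a) ∧ ∀ u ∈ U, s u = D u})
    (hne : C.Nonempty) :
    uniformOn C = ((PMF.uniformOfFintype (Fin (1 + 1))).bind fun r =>
      uniformOn (walkSet τ η e U D x (decide (r.val = 1)))) ∧
    ∀ b, (walkSet τ η e U D x b).Nonempty := by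
  classical
  by_cases hx : ∃ a, a ∉ U ∧ (e a).val = x
  swap
  · have hw : ∀ b, walkSet τ η e U D x b = C := by
      intro b
      rw [hC]; ext s
      exact and_congr_right fun _ => and_iff_left fun a ha hax => absurd ⟨a, ha, hax⟩ hx
    simp only [hw]
    exact ⟨(PMF.bind_const _ _).symm, fun _ => hne⟩
  obtain ⟨a, ha, rfl⟩ := hx
  have hw : ∀ b, walkSet τ η e U D (e a) b = {s ∈ C | s a = b} := by
    intro b
    rw [hC]; ext s
    simp only [walkSet, Set.mem_ofPred_eq, and_assoc]
    refine and_congr_right fun _ => and_congr_right fun _ => ⟨fun h => h a ha rfl, ?_⟩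
    intro h a' _ haa
    rw [e.injective (Fin.ext haa), h]
  let flip : (A → Bool) → A → Bool := fun s u => if u ∈ U then s u else !s u
  have hff : ∀ s, flip (flip s) = s := by
    intro s; funext u; by_cases hu : u ∈ U <;> simp [flip, hu]
  have hτU : ∀ u, τ u ∈ U ↔ u ∈ U := fun u => ⟨fun h => hτ u ▸ htau _ h, htau u⟩
  have hηU : ∀ u, η u ∈ U ↔ u ∈ U := fun u => ⟨fun h => hη u ▸ heta _ h, heta u⟩
  have hflip : ∀ s ∈ C, flip s ∈ C := by
    intro s hs
    rw [hC] at hs ⊢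
    refine ⟨fun u => ?_, fun u hu => ?_⟩
    · simp only [flip, hτU, hηU, (hs.1 u).1, (hs.1 u).2]
      split_ifs <;> simp
    · simp only [flip, if_pos hu]; exact hs.2 u hu
  have hfa : ∀ s, flip s a = !s a := fun s => if_neg ha
  have hcard : {s ∈ C | s a = false}.ncard = {s ∈ C | s a = true}.ncard := by
    refine Set.ncard_congr (fun s _ => flip s) ?_ ?_ ?_
    · rintro s ⟨h1, h2⟩; exact ⟨hflip s h1, by rw [hfa, h2]; rfl⟩
    · intro s s' _ _ h; rw [← hff s, ← hff s', h]
    · rintro s ⟨h1, h2⟩; exact ⟨flip s, ⟨hflip s h1, by rw [hfa, h2]; rfl⟩, hff s⟩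
  have hnot : {s ∈ C | ¬ s a = false} = {s ∈ C | s a = true} := by ext s; simp
  have hadd : {s ∈ C | s a = false}.ncard + {s ∈ C | s a = true}.ncard = C.ncard := by
    rw [← Set.ncard_union_eq _ (Set.toFinite _) (Set.toFinite _)]
    · congr 1; ext s; simp only [Set.mem_union, Set.mem_ofPred_eq]; cases s a <;> simp
    · rw [Set.disjoint_left]; rintro s ⟨_, h⟩ ⟨_, h'⟩; simp [h] at h'
  refine ⟨?_, fun b => ?_⟩
  · rw [uniformOn_eq_bind hne (fun s => s a = false) (b := 1) (N := 1) (by omega)]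
    congr 1
    funext r
    rw [hw, hnot]
    have hr := r.2
    by_cases h : r.val < 1
    · rw [if_pos h, decide_eq_false (by omega)]
    · rw [if_neg h, decide_eq_true (by omega)]
  · rw [hw]
    obtain ⟨s, hs⟩ := hne
    by_cases h : s a = b
    · exact ⟨s, hs, h⟩
    · exact ⟨flip s, hflip s hs, by rw [hfa]; revert h; cases s a <;> cases b <;> simp⟩

end Tours

/-- The number of the other copy of a split vertex. -/
def otherCopy (v : Expr) : Expr :=
  .bin .sub (.bin .add v (.lit 1)) (.bin .mul (.lit 2) (.bin .mod v (.lit 2)))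

/-- The place, in the arrays `4` and `5`, for the arc of the color of the arc `x` at the split
vertex `v`; variable `3` is the number of colors. -/
def slot (v x : Expr) : Expr := .bin .add (.bin .mul v (.var 3)) (.get 2 x)

/-- Marks the arc in variable `5` by the part in variable `6` and its partner by the other part,
and moves on to the next arc of the tour. -/
def markProg : Prog :=
  .seq (.store 6 (.var 5) (.bin .add (.var 6) (.lit 1))) <|
  .seq (.assign 5 (.get 4 (slot (otherCopy (.get 0 (.var 5))) (.var 5)))) <|
  .seq (.store 6 (.var 5) (.bin .sub (.lit 2) (.var 6))) <|
  .assign 5 (.get 5 (slot (otherCopy (.get 1 (.var 5))) (.var 5)))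

/-- Follows the tours; the entries of array `6` are `0` for the arcs not yet visited and `1` or `2`
for the others, according to their part.  Whenever the walk stands at a visited arc it moves on to
the next arc of the list, with a new coin. -/
def walkLoop : Prog :=
  .while (.bin .lt (.var 4) (.var 2)) <| .ite (.get 6 (.var 5))
    (.seq (.assign 4 (.bin .add (.var 4) (.lit 1))) <|
      .seq (.assign 5 (.var 4)) <| .rand 6 (.lit 2))
    markProg

/-- Draws an alternating division. -/
def walkProg : Prog :=
  .seq (.assign 4 (.lit 0)) <| .seq (.assign 5 (.lit 0)) <| .seq (.rand 6 (.lit 2)) walkLoop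

section WalkLaw

universe u

variable {A X : Type u} {M W k : ℕ} {e : A ≃ Fin M} {τ η : A → A} {K : List Prog} {f : Mem → X}

/-- The number of the other copy of a split vertex. -/
def other (v : ℕ) : ℕ := v + 1 - 2 * (v % 2)

/-- The memory holds a split graph with a coloring, and the tables for the partners. -/
structure Tables (e : A ≃ Fin M) (τ η : A → A) (k : ℕ) (m : Mem) : Prop where
  var2 : m.var 2 = M
  var3 : m.var 3 = k
  tail_lt : ∀ a, m.arr 0 (e a) < M
  head_lt : ∀ a, m.arr 1 (e a) < M
  col_le : ∀ a, m.arr 2 (e a) ≤ k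
  tail : ∀ a, m.arr 4 (other (m.arr 0 (e a)) * k + m.arr 2 (e a)) = e (τ a)
  head : ∀ a, m.arr 5 (other (m.arr 1 (e a)) * k + m.arr 2 (e a)) = e (η a)

theorem other_le {v M : ℕ} (hv : v < M) : other v ≤ M := by unfold other; omega

theorem other_two_mul_add (v : ℕ) (b : Bool) : other (2 * v + b.toNat) = 2 * v + (!b).toNat := by
  unfold other; cases b <;> simp

theorem slot_fits {m : Mem} {α : ℕ} {a : A} (hW : (M + 2) ^ 2 ≤ W) (hkM : k ≤ M)
    (h3 : m.var 3 = k) (h5 : m.var 5 = e a) (hlt : m.arr α (e a) < M) (hc : m.arr 2 (e a) ≤ k) :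
    (slot (otherCopy (.get α (.var 5))) (.var 5)).Fits W m ∧
      (slot (otherCopy (.get α (.var 5))) (.var 5)).val m =
        other (m.arr α (e a)) * k + m.arr 2 (e a) := by
  have h1 : other (m.arr α (e a)) * k ≤ M * M := Nat.mul_le_mul (other_le hlt) hkM
  have h2 : M * M + 4 * M + 4 ≤ W := by rw [sq] at hW; nlinarith
  have hea := (e a).2
  unfold other at h1
  refine ⟨?_, by simp [slot, otherCopy, Expr.val, Op.apply, other, h3, h5]⟩
  simp only [slot, otherCopy, Expr.Fits, Expr.val, Op.apply, h3, h5]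
  omega

/-- The memory during the walk. -/
structure WalkInv (e : A ≃ Fin M) (m₀ : Mem) (U : Set A) (D : A → Bool) (j x : ℕ) (b : Bool)
    (m : Mem) : Prop where
  var : ∀ i < 4, m.var i = m₀.var i
  arr : ∀ β, β ≠ 6 → m.arr β = m₀.arr β
  var4 : m.var 4 = j
  var5 : m.var 5 = x
  var6 : m.var 6 = b.toNat
  visited : ∀ a ∈ U, m.arr 6 (e a) = (D a).toNat + 1
  unvisited : ∀ a, a ∉ U → m.arr 6 (e a) = 0

/-- From any reachable point of the loop on, the division that is finally produced is uniform among
those that agree with the choices made so far.  Each round either moves on to the next arc of the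
list or visits new arcs, so that the number of the arcs that are still ahead in the list plus the
number of unvisited arcs bounds the number of rounds. -/
theorem law_walkLoop [Finite A] (hW : (M + 2) ^ 2 ≤ W) (hkM : k ≤ M) {m₀ : Mem}
    (h₀ : Tables e τ η k m₀) (hτ : ∀ a, τ (τ a) = a) (hη : ∀ a, η (η a) = a)
    (hτ' : ∀ a, τ a ≠ a) (hη' : ∀ a, η a ≠ a) {T : ℕ} {μ : (A → Bool) → PMF X}
    (hK : ∀ d : A → Bool, (∀ a, d (τ a) = !d a ∧ d (η a) = !d a) → ∀ m',
      (∀ i < 4, m'.var i = m₀.var i) → (∀ β, β ≠ 6 → m'.arr β = m₀.arr β) →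
      (∀ a, m'.arr 6 (e a) = (d a).toNat + 1) → Law W T ⟨K, m'⟩ f (μ d))
    (i j x : ℕ) (b : Bool) (U : Set A) (D : A → Bool) (m : Mem) (hjM : j ≤ M)
    (hi : M - j + Uᶜ.ncard ≤ i) (hI : WalkInv e m₀ U D j x b m)
    (hS : WalkState τ η e U j x) (hne : (walkSet τ η e U D x b).Nonempty) :
    Law W (T + i * 9 + 1) ⟨walkLoop :: K, m⟩ f
      ((uniformOn (walkSet τ η e U D x b)).bind μ) := by
  classical
  have hM2 : M * M + 4 * M + 4 ≤ W := by rw [sq] at hW; nlinarith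
  induction i using Nat.strong_induction_on generalizing j x b U D m with
  | _ i ih =>
    have hv2 : m.var 2 = M := by rw [hI.var 2 (by omega), h₀.var2]
    have hv3 : m.var 3 = k := by rw [hI.var 3 (by omega), h₀.var3]
    rcases Nat.eq_or_lt_of_le hjM with rfl | hjM
    · -- everything has been visited
      have hU : ∀ a, a ∈ U := fun a => hS.below a (e a).2
      have hset : walkSet τ η e U D x b = {D} := by
        obtain ⟨s, hs⟩ := hne
        ext s'
        refine ⟨fun hs' => funext fun a => hs'.2.1 a (hU a), ?_⟩
        rintro rfl
        have : s = s' := funext fun a => hs.2.1 a (hU a)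
        exact this ▸ hs
      have hD : D ∈ walkSet τ η e U D x b := by rw [hset]; rfl
      rw [hset, uniformOn_singleton, PMF.pure_bind]
      refine Law.mono (law_while_false ?_ ?_ (hK D hD.1 m hI.var hI.arr
        fun a => hI.visited a (hU a))) (by omega)
      · simp only [Expr.Fits, Op.apply, Expr.val, hv2, hI.var4, lt_irrefl, if_false]; omega
      · simp [Op.apply, Expr.val, hv2, hI.var4]
    obtain ⟨i, rfl⟩ : ∃ i', i = i' + 1 := ⟨i - 1, by omega⟩
    obtain ⟨y, rfl⟩ : ∃ y, x = (e y).val := by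
      rcases hS.pos with ⟨rfl, -⟩ | ⟨y, -, rfl, -⟩
      · exact ⟨e.symm ⟨x, hjM⟩, by simp⟩
      · exact ⟨y, rfl⟩
    have hey := (e y).2
    rw [add_one_mul]
    refine Law.mono (T := T + i * 9 + 1 + 7 + 1 + 1) (law_while_true ?_ ?_ ?_) (by omega)
    · simp only [Expr.Fits, Op.apply, Expr.val, hv2, hI.var4, if_pos hjM]; omega
    · simp [Op.apply, Expr.val, hv2, hI.var4, hjM]
    by_cases hy : y ∈ U
    · -- a tour has been closed
      have hD := Bool.toNat_le (D y)
      have hvis := hI.visited y hy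
      have hU : (e y).val = j ∧ ∀ u ∈ U, η u ∈ U := by
        rcases hS.pos with h | ⟨y', -, h1, -, h2, -⟩
        · exact h
        · exact absurd hy (e.injective (Fin.ext h1) ▸ h2)
      refine law_ite_true ?_ ?_ (Law.mono (T := T + i * 9 + 1 + 1 + 1 + 1 + 1 + 1) ?_ (by omega))
      · simp only [Expr.Fits, Expr.val, hI.var5, hvis]; omega
      · simp [Expr.val, hI.var5, hvis]
      set C : Set (A → Bool) :=
        {s | (∀ a, s (τ a) = !s a ∧ s (η a) = !s a) ∧ ∀ u ∈ U, s u = D u} with hC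
      have hset : walkSet τ η e U D (e y) b = C := by
        ext s
        exact and_congr_right fun _ => and_iff_left fun a ha hax =>
          absurd hy (e.injective (Fin.ext hax) ▸ ha)
      rw [hset] at hne ⊢
      obtain ⟨hcoin, hne'⟩ := uniformOn_walkSet_coin (e := e) hS.tau hU.2 hτ hη (j + 1) hC hne
      rw [hcoin, PMF.bind_bind]
      refine law_seq (law_res (p := .assign 4 _) ?_ (law_seq (law_res (p := .assign 5 _) ?_
        (law_rand ?_ ?_ fun r => ?_))))
      · simp only [Prog.Fits, Expr.Fits, Expr.val, Op.apply, hI.var4]; omega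
      · simp [Prog.Fits, Prog.res, Expr.Fits, Expr.val, Op.apply, hI.var4]; omega
      · simp only [Expr.Fits]; omega
      · rfl
      · refine ih i (by omega) (j + 1) (j + 1) _ U D _ (by omega) (by omega) ?_ ?_ (hne' _)
        · have hr := r.2
          refine ⟨fun i hi => ?_, hI.arr, by simp [Prog.res, Expr.val, Op.apply, hI.var4],
            by simp [Prog.res, Expr.val, Op.apply, hI.var4], ?_, hI.visited, hI.unvisited⟩
          · simp only [Prog.res, setVar_var]
            rw [if_neg (by omega), if_neg (by omega), if_neg (by omega)]; exact hI.var i hi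
          · simp only [Prog.res, setVar_var, if_true]
            by_cases h1 : r.val = 1
            · simp [h1]
            · simp [h1]; omega
        · refine ⟨hS.tau, fun a ha => ?_, .inl ⟨rfl, hU.2⟩⟩
          by_cases haj : (e a).val = j
          · rw [← hU.1] at haj; exact e.injective (Fin.ext haj) ▸ hy
          · exact hS.below a (by omega)
    · have hunv := hI.unvisited y hy
      have hτy : τ y ∉ U := fun hm => hy (hτ y ▸ hS.tau _ hm)
      have hb := Bool.toNat_le b
      refine law_ite_false ?_ ?_ (Law.mono (T := T + i * 9 + 1 + markProg.size) ?_ le_rfl)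
      · simp only [Expr.Fits, Expr.val, hI.var5, hunv]; omega
      · simp [Expr.val, hI.var5, hunv]
      rw [walkSet_mark hτ hS.tau hτ' hy] at hne ⊢
      set D' : A → Bool := fun a => if a = y then b else if a = τ y then !b else D a with hD'
      have heinj : ∀ a a' : A, (e a).val = (e a').val ↔ a = a' := fun a a' =>
        ⟨fun h => e.injective (Fin.ext h), fun h => by rw [h]⟩
      -- the two lookups
      have hl := slot_fits (a := y) (α := 0) (e := e) (m := m.setArr 6 (e y) (b.toNat + 1)) hW hkM
        hv3 hI.var5 (by simpa [hI.arr] using h₀.tail_lt y) (by simpa [hI.arr] using h₀.col_le y)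
      have hl' := slot_fits (a := τ y) (α := 1) (e := e)
        (m := ((m.setArr 6 (e y) (b.toNat + 1)).setVar 5 (e (τ y))).setArr 6 (e (τ y))
          (2 - b.toNat)) hW hkM (by simpa using hv3) (by simp)
        (by simpa [hI.arr] using h₀.head_lt (τ y)) (by simpa [hI.arr] using h₀.col_le (τ y))
      have hτv := h₀.tail y
      have hηv := h₀.head (τ y)
      simp only [setArr_arr, setVar_arr, hI.arr 0 (by omega), hI.arr 1 (by omega),
        hI.arr 2 (by omega), show ¬ (0 : ℕ) = 6 by omega, show ¬ (1 : ℕ) = 6 by omega,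
        show ¬ (2 : ℕ) = 6 by omega, false_and, if_false] at hl hl'
      have heτ := (e (τ y)).2
      have heη := (e (η (τ y))).2
      have hres1 : (Prog.store 6 (.var 5) (.bin .add (.var 6) (.lit 1))).res m =
          m.setArr 6 (e y) (b.toNat + 1) := by
        simp [Prog.res, Expr.val, Op.apply, hI.var5, hI.var6]
      have hres2 : (Prog.assign 5 (.get 4 (slot (otherCopy (.get 0 (.var 5))) (.var 5)))).res
          (m.setArr 6 (e y) (b.toNat + 1)) =
          (m.setArr 6 (e y) (b.toNat + 1)).setVar 5 (e (τ y)) := by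
        rw [Prog.res, Expr.val, hl.2, setArr_arr_of_ne _ _ _ (by omega), hI.arr 4 (by omega), hτv]
      have hres3 : (Prog.store 6 (.var 5) (.bin .sub (.lit 2) (.var 6))).res
          ((m.setArr 6 (e y) (b.toNat + 1)).setVar 5 (e (τ y))) =
          ((m.setArr 6 (e y) (b.toNat + 1)).setVar 5 (e (τ y))).setArr 6 (e (τ y))
            (2 - b.toNat) := by
        simp [Prog.res, Expr.val, Op.apply, hI.var6]
      have hres4 : (Prog.assign 5 (.get 5 (slot (otherCopy (.get 1 (.var 5))) (.var 5)))).res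
          (((m.setArr 6 (e y) (b.toNat + 1)).setVar 5 (e (τ y))).setArr 6 (e (τ y))
            (2 - b.toNat)) = (((m.setArr 6 (e y) (b.toNat + 1)).setVar 5 (e (τ y))).setArr 6
            (e (τ y)) (2 - b.toNat)).setVar 5 (e (η (τ y))) := by
        rw [Prog.res, Expr.val, hl'.2, setArr_arr_of_ne _ _ _ (by omega), setVar_arr,
          setArr_arr_of_ne _ _ _ (by omega), hI.arr 5 (by omega), hηv]
      have hmem : ∀ u, u ∈ insert y (insert (τ y) U) ↔ u = y ∨ u = τ y ∨ u ∈ U := fun u => by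
        simp only [Set.mem_insert_iff]
      refine law_res ?_ (ih i (by omega) j (e (η (τ y))) b _ D' _ hjM.le ?_ ?_
        (hS.mark hτ hη hτ' hη' hy hjM) hne)
      · simp only [markProg, Prog.Fits, hres1, hres2, hres3]
        refine ⟨?_, ⟨hl.1, ?_⟩, ?_, ⟨hl'.1, ?_⟩⟩
        · simp only [Expr.Fits, Expr.val, Op.apply, hI.var5, hI.var6]; omega
        · rw [hl.2, setArr_arr_of_ne _ _ _ (by omega), hI.arr 4 (by omega), hτv]; omega
        · simp [Expr.Fits, Expr.val, Op.apply, hI.var6]; omega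
        · rw [hl'.2, setArr_arr_of_ne _ _ _ (by omega), setVar_arr,
            setArr_arr_of_ne _ _ _ (by omega), hI.arr 5 (by omega), hηv]; omega
      · have hlt : (insert y (insert (τ y) U))ᶜ.ncard < Uᶜ.ncard := by
          refine Set.ncard_lt_ncard ?_ (Set.toFinite _)
          refine ⟨fun a ha hU => ha (.inr (.inr hU)), fun h => ?_⟩
          exact h (show y ∈ Uᶜ from hy) (.inl rfl)
        omega
      · simp only [markProg, Prog.res_seq, hres1, hres2, hres3, hres4]
        refine ⟨fun i hi => ?_, fun β hβ => ?_, ?_, by simp, ?_, fun a ha => ?_, fun a ha => ?_⟩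
        · simp only [setVar_var, setArr_var]
          rw [if_neg (by omega), if_neg (by omega)]; exact hI.var i hi
        · rw [setVar_arr, setArr_arr_of_ne _ _ _ hβ, setVar_arr, setArr_arr_of_ne _ _ _ hβ]
          exact hI.arr β hβ
        · simpa using hI.var4
        · simpa using hI.var6
        · simp only [setVar_arr, setArr_arr, true_and, heinj, hD']
          by_cases h1 : a = y
          · have h2 : a ≠ τ y := fun h => hτ' y (h.symm.trans h1)
            simp only [if_neg h2, if_pos h1]
          · by_cases h2 : a = τ y
            · simp only [if_pos h2, if_neg h1]
              cases b <;> rfl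
            · simp only [if_neg h2, if_neg h1]
              rw [hmem] at ha
              exact hI.visited a (by tauto)
        · rw [hmem] at ha
          simp only [setVar_arr, setArr_arr, true_and, heinj]
          rw [if_neg (by tauto), if_neg (by tauto)]
          exact hI.unvisited a (by tauto)

theorem law_walkProg [Finite A] (hW : (M + 2) ^ 2 ≤ W) (hkM : k ≤ M) {m₀ : Mem}
    (h₀ : Tables e τ η k m₀) (hτ : ∀ a, τ (τ a) = a) (hη : ∀ a, η (η a) = a)
    (hτ' : ∀ a, τ a ≠ a) (hη' : ∀ a, η a ≠ a) (h6 : ∀ a, m₀.arr 6 (e a) = 0)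
    {C : Set (A → Bool)} (hC : C = {d | ∀ a, d (τ a) = !d a ∧ d (η a) = !d a}) {T : ℕ}
    {μ : (A → Bool) → PMF X} (hK : ∀ d ∈ C, ∀ m', (∀ i < 4, m'.var i = m₀.var i) →
      (∀ β, β ≠ 6 → m'.arr β = m₀.arr β) →
      (∀ a, m'.arr 6 (e a) = (d a).toNat + 1) → Law W T ⟨K, m'⟩ f (μ d)) :
    Law W (T + (M * 18 + 7)) ⟨walkProg :: K, m₀⟩ f ((uniformOn C).bind μ) := by
  have hM2 : M * M + 4 * M + 4 ≤ W := by rw [sq] at hW; nlinarith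
  have hset : C = {s | (∀ a, s (τ a) = !s a ∧ s (η a) = !s a) ∧
      ∀ u ∈ (∅ : Set A), s u = (fun _ => false : A → Bool) u} := by
    rw [hC]; ext s; simp
  have hne : C.Nonempty := by rw [hC]; exact exists_alternating hτ hη hτ' hη'
  obtain ⟨hcoin, hne'⟩ := uniformOn_walkSet_coin (e := e) (τ := τ) (η := η) (U := ∅)
    (D := fun _ => false) (fun u hu => hu.elim) (fun u hu => hu.elim) hτ hη 0 hset hne
  have hcard : (∅ : Set A)ᶜ.ncard = M := by
    rw [Set.compl_empty, Set.ncard_univ, Nat.card_congr e, Nat.card_eq_fintype_card,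
      Fintype.card_fin]
  rw [hcoin, PMF.bind_bind]
  refine Law.mono (law_seq (law_res (p := .assign 4 _) ?_ (law_seq (law_res (p := .assign 5 _) ?_
    (law_seq (law_rand ?_ ?_ fun r => law_walkLoop hW hkM h₀ hτ hη hτ' hη'
      (fun d hd => hK d (by rw [hC]; exact hd)) (M + M) 0 0 (decide (r.val = 1)) ∅
      (fun _ => false) _ (by omega) (by omega) ?_ ?_ (hne' _))))))) ?_
  · simp only [Prog.Fits, Expr.Fits]; omega
  · simp only [Prog.Fits, Expr.Fits]; omega
  · simp only [Expr.Fits]; omega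
  · rfl
  · have hr := r.2
    refine ⟨fun i hi => ?_, fun _ _ => rfl, by simp [Prog.res, Expr.val],
      by simp [Prog.res, Expr.val], ?_, fun a ha => ha.elim, fun a _ => h6 a⟩
    · simp only [Prog.res, setVar_var]
      rw [if_neg (by omega), if_neg (by omega), if_neg (by omega)]
    · simp only [Prog.res, setVar_var, if_true]
      by_cases h1 : r.val = 1
      · simp [h1]
      · simp [h1]; omega
  · exact ⟨fun u hu => hu.elim, fun a ha => by omega, .inl ⟨rfl, fun u hu => hu.elim⟩⟩
  · simp only [Prog.size]; omega

end WalkLaw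

/-! ### The program, one level of the recursion -/

/-- Enters the current arc into the tables for its tail and its head, and marks it unvisited. -/
def tabulateArc : Prog :=
  .seq (.store 4 (slot (.get 0 (.var 4)) (.var 4)) (.var 4)) <|
  .seq (.store 5 (slot (.get 1 (.var 4)) (.var 4)) (.var 4)) <|
  .store 6 (.var 4) (.lit 0)

/-- Recolors the current arc according to its part, and fuses the copies of its ends. -/
def fuseArc : Prog :=
  .seq (.store 2 (.var 4) (.bin .add (.get 2 (.var 4))
    (.bin .mul (.var 3) (.bin .sub (.get 6 (.var 4)) (.lit 1))))) <|
  .seq (.store 0 (.var 4) (.bin .div (.get 0 (.var 4)) (.lit 2))) <|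
  .store 1 (.var 4) (.bin .div (.get 1 (.var 4)) (.lit 2))

/-- The recoloring step: from a coloring of the split graph to one of the graph. -/
def mergeProg : Prog :=
  .seq (forArcs tabulateArc) <| .seq walkProg <| .seq (forArcs fuseArc) <|
  .assign 3 (.bin .mul (.var 3) (.lit 2))

section MergeLaw

universe u

variable {A V X : Type u} {M W k : ℕ} {e : A ≃ Fin M} {K : List Prog} {f : Mem → X}

/-- Colors start at `1`, so that the places for different vertices do not overlap. -/
theorem slot_injective {v v' c c' k : ℕ} (hc : c ∈ Finset.Icc 1 k) (hc' : c' ∈ Finset.Icc 1 k)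
    (h : v * k + c = v' * k + c') : v = v' ∧ c = c' := by
  rw [Finset.mem_Icc] at hc hc'
  rcases lt_trichotomy v v' with hlt | rfl | hlt
  · have : (v + 1) * k ≤ v' * k := Nat.mul_le_mul_right k hlt
    rw [add_one_mul] at this; omega
  · exact ⟨rfl, by omega⟩
  · have : (v' + 1) * k ≤ v * k := Nat.mul_le_mul_right k hlt
    rw [add_one_mul] at this; omega

/-- The memory holds the graph, with arcs numbered by `e` and vertices numbered by `num`. -/
structure Holds (e : A ≃ Fin M) (num : V → ℕ) (tail head : A → V) (k₀ k : ℕ) (m : Mem) :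
    Prop where
  var1 : m.var 1 = k₀
  var2 : m.var 2 = M
  var3 : m.var 3 = k
  tail : ∀ a, m.arr 0 (e a) = num (tail a)
  head : ∀ a, m.arr 1 (e a) = num (head a)

/-- The number of a copy of a split vertex. -/
def splitNum (num : V → ℕ) (v : V × Bool) : ℕ := 2 * num v.1 + v.2.toNat

theorem splitNum_injective {num : V → ℕ} (h : Function.Injective num) :
    Function.Injective (splitNum num) := by
  rintro ⟨v, b⟩ ⟨v', b'⟩ hv
  have h1 : 2 * num v + b.toNat = 2 * num v' + b'.toNat := hv
  have h2 := Bool.toNat_le b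
  have h3 := Bool.toNat_le b'
  have h4 : num v = num v' := by omega
  have h5 : b.toNat = b'.toNat := by omega
  rw [h h4]
  revert h5; cases b <;> cases b' <;> simp

/-- After the loop, the entry of the tables at the place of the other copy is the partner. -/
theorem law_tabulate (hW : (M + 2) ^ 2 ≤ W) (hkM : k ≤ M) {num : V → ℕ}
    (hnum : Function.Injective num) {k₀ : ℕ} {tail head : A → V} {s t : A → Bool} {c : A → ℕ}
    {τ η : A → A} (hc : ∀ a, c a ∈ Finset.Icc 1 k)
    (hτ : ∀ a b, b = τ a ↔ c b = c a ∧ tail b = tail a ∧ s b = !s a)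
    (hη : ∀ a b, b = η a ↔ c b = c a ∧ head b = head a ∧ t b = !t a)
    (hlt : ∀ v, 2 * num v + 1 < M) {m₀ : Mem}
    (h₀ : Holds e (splitNum num) (fun a => (tail a, s a)) (fun a => (head a, t a)) k₀ k m₀)
    (hcol : ∀ a, m₀.arr 2 (e a) = c a) {T : ℕ} {μ : PMF X}
    (hK : ∀ m, Tables e τ η k m → (∀ a, m.arr 6 (e a) = 0) → (∀ i < 4, m.var i = m₀.var i) →
      (∀ β < 3, m.arr β = m₀.arr β) → Law W T ⟨K, m⟩ f μ) :
    Law W (T + (M * 8 + 3)) ⟨forArcs tabulateArc :: K, m₀⟩ f μ := by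
  have hM2 : M * M + 4 * M + 4 ≤ W := by rw [sq] at hW; nlinarith
  let I : ℕ → Mem → Prop := fun j m => (∀ i < 4, m.var i = m₀.var i) ∧
    (∀ β < 3, m.arr β = m₀.arr β) ∧ ∀ a, (e a).val < j →
      m.arr 4 ((2 * num (tail a) + (s a).toNat) * k + c a) = e a ∧
      m.arr 5 ((2 * num (head a) + (t a).toNat) * k + c a) = e a ∧ m.arr 6 (e a) = 0
  have hτs : ∀ a, other (2 * num (tail a) + (s a).toNat) =
      2 * num (tail (τ a)) + (s (τ a)).toNat := by
    intro a
    have h := (hτ a (τ a)).1 rfl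
    rw [other_two_mul_add, h.2.1, h.2.2]
  have hηt : ∀ a, other (2 * num (head a) + (t a).toNat) =
      2 * num (head (η a)) + (t (η a)).toNat := by
    intro a
    have h := (hη a (η a)).1 rfl
    rw [other_two_mul_add, h.2.1, h.2.2]
  have hvlt : ∀ v (b : Bool), 2 * num v + b.toNat < M := fun v b => by
    have := hlt v; have := Bool.toNat_le b; omega
  refine law_forArcs (body := tabulateArc) (by omega) I ?_ h₀.var2 ?_ ?_
  · intro j hj m h2 h4 hI
    obtain ⟨a₀, ha₀⟩ : ∃ a₀ : A, (e a₀).val = j := ⟨e.symm ⟨j, hj⟩, by simp⟩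
    have hm3 : m.var 3 = k := by rw [hI.1 3 (by omega), h₀.var3]
    have ht : m.arr 0 j = 2 * num (tail a₀) + (s a₀).toNat := by
      rw [hI.2.1 0 (by omega), ← ha₀, h₀.tail]; rfl
    have hh : m.arr 1 j = 2 * num (head a₀) + (t a₀).toNat := by
      rw [hI.2.1 1 (by omega), ← ha₀, h₀.head]; rfl
    have hcm : m.arr 2 j = c a₀ := by rw [hI.2.1 2 (by omega), ← ha₀, hcol]
    have hck := Finset.mem_Icc.1 (hc a₀)
    have h1 : (2 * num (tail a₀) + (s a₀).toNat) * k ≤ M * M :=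
      Nat.mul_le_mul (hvlt _ _).le hkM
    have h1' : (2 * num (head a₀) + (t a₀).toNat) * k ≤ M * M :=
      Nat.mul_le_mul (hvlt _ _).le hkM
    have hvt := hvlt (tail a₀) (s a₀)
    have hvh := hvlt (head a₀) (t a₀)
    have hres : tabulateArc.res m = ((m.setArr 4
        ((2 * num (tail a₀) + (s a₀).toNat) * k + c a₀) j).setArr 5
        ((2 * num (head a₀) + (t a₀).toNat) * k + c a₀) j).setArr 6 j 0 := by
      simp [tabulateArc, slot, Prog.res, Expr.val, Op.apply, hm3, h4, ht, hh, hcm]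
    rw [hres]
    refine ⟨?_, h2, h4, ?_, ?_, ?_⟩
    · simp [tabulateArc, slot, Prog.Fits, Prog.res, Expr.Fits, Expr.val, Op.apply, hm3, h4, ht,
        hh, hcm]
      omega
    · intro i hi
      simp only [setVar_var, setArr_var]
      rw [if_neg (by omega)]; exact hI.1 i hi
    · intro β hβ
      rw [setVar_arr, setArr_arr_of_ne _ _ _ (by omega), setArr_arr_of_ne _ _ _ (by omega),
        setArr_arr_of_ne _ _ _ (by omega)]
      exact hI.2.1 β hβ
    · intro a ha
      simp only [setVar_arr, setArr_arr, true_and, show ¬ (4 : ℕ) = 6 by omega,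
        show ¬ (4 : ℕ) = 5 by omega, show ¬ (5 : ℕ) = 6 by omega, show ¬ (6 : ℕ) = 5 by omega,
        show ¬ (6 : ℕ) = 4 by omega, show ¬ (5 : ℕ) = 4 by omega, false_and, if_false]
      by_cases haj : (e a).val = j
      · have : a = a₀ := e.injective (Fin.ext (haj.trans ha₀.symm))
        rw [if_pos haj, if_pos (by rw [this]), if_pos (by rw [this])]
        exact ⟨haj.symm, haj.symm, rfl⟩
      · obtain ⟨h3, h4, h5⟩ := hI.2.2 a (by omega)
        rw [if_neg haj]
        refine ⟨?_, ?_, h5⟩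
        · split_ifs with h
          · obtain ⟨hv, hcc⟩ := slot_injective (hc a) (hc a₀) h
            have hv' := splitNum_injective hnum
              (a₁ := (tail a, s a)) (a₂ := (tail a₀, s a₀)) hv
            rw [Prod.mk.injEq] at hv'
            rw [eq_of_partner hτ hcc hv'.1 hv'.2, ha₀]
          · exact h3
        · split_ifs with h
          · obtain ⟨hv, hcc⟩ := slot_injective (hc a) (hc a₀) h
            have hv' := splitNum_injective hnum
              (a₁ := (head a, t a)) (a₂ := (head a₀, t a₀)) hv
            rw [Prod.mk.injEq] at hv'
            rw [eq_of_partner hη hcc hv'.1 hv'.2, ha₀]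
          · exact h4
  · refine ⟨fun i hi => ?_, fun β _ => rfl, fun a ha => by omega⟩
    simp only [setVar_var]; rw [if_neg (by omega)]
  · intro m h2 hI
    have ht : ∀ a, m.arr 0 (e a) = 2 * num (tail a) + (s a).toNat := fun a => by
      rw [hI.2.1 0 (by omega), h₀.tail]; rfl
    have hh : ∀ a, m.arr 1 (e a) = 2 * num (head a) + (t a).toNat := fun a => by
      rw [hI.2.1 1 (by omega), h₀.head]; rfl
    have hcm : ∀ a, m.arr 2 (e a) = c a := fun a => by rw [hI.2.1 2 (by omega), hcol]
    refine hK m ⟨h2, by rw [hI.1 3 (by omega), h₀.var3], fun a => by rw [ht]; exact hvlt _ _,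
      fun a => by rw [hh]; exact hvlt _ _, fun a => by rw [hcm]; exact (Finset.mem_Icc.1 (hc a)).2,
      fun a => ?_, fun a => ?_⟩ (fun a => (hI.2.2 a (e a).2).2.2) hI.1 hI.2.1
    · rw [ht, hcm, hτs, ← ((hτ a (τ a)).1 rfl).1]
      exact (hI.2.2 (τ a) (e _).2).1
    · rw [hh, hcm, hηt, ← ((hη a (η a)).1 rfl).1]
      exact (hI.2.2 (η a) (e _).2).2.1

/-- Halving the number of a copy gives the number of the vertex. -/
theorem law_fuse (hW : (M + 2) ^ 2 ≤ W) (hkM : k ≤ M) {num : V → ℕ} {k₀ : ℕ}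
    {tail head : A → V} {s t d : A → Bool} {c : A → ℕ} (hc : ∀ a, c a ≤ k)
    (hlt : ∀ v, 2 * num v + 1 < M) {m₀ : Mem}
    (h₀ : Holds e (splitNum num) (fun a => (tail a, s a)) (fun a => (head a, t a)) k₀ k m₀)
    (hcol : ∀ a, m₀.arr 2 (e a) = c a) (hd : ∀ a, m₀.arr 6 (e a) = (d a).toNat + 1) {T : ℕ}
    {μ : PMF X}
    (hK : ∀ m, (∀ i < 4, m.var i = m₀.var i) → (∀ a, m.arr 0 (e a) = num (tail a)) →
      (∀ a, m.arr 1 (e a) = num (head a)) → (∀ a, m.arr 2 (e a) = recolor c d k a) →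
      Law W T ⟨K, m⟩ f μ) :
    Law W (T + (M * 8 + 3)) ⟨forArcs fuseArc :: K, m₀⟩ f μ := by
  have hM2 : M * M + 4 * M + 4 ≤ W := by rw [sq] at hW; nlinarith
  have hvlt : ∀ v (b : Bool), 2 * num v + b.toNat < M := fun v b => by
    have := hlt v; have := Bool.toNat_le b; omega
  let I : ℕ → Mem → Prop := fun j m => (∀ i < 4, m.var i = m₀.var i) ∧ m.arr 6 = m₀.arr 6 ∧
    ∀ a, m.arr 0 (e a) = (if (e a).val < j then num (tail a)
        else 2 * num (tail a) + (s a).toNat) ∧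
      m.arr 1 (e a) = (if (e a).val < j then num (head a)
        else 2 * num (head a) + (t a).toNat) ∧
      m.arr 2 (e a) = if (e a).val < j then recolor c d k a else c a
  refine law_forArcs (body := fuseArc) (by omega) I ?_ h₀.var2 ?_ ?_
  · intro j hj m h2 h4 hI
    obtain ⟨a₀, ha₀⟩ : ∃ a₀ : A, (e a₀).val = j := ⟨e.symm ⟨j, hj⟩, by simp⟩
    have hm3 : m.var 3 = k := by rw [hI.1 3 (by omega), h₀.var3]
    obtain ⟨ht, hh, hcm⟩ := hI.2.2 a₀
    rw [if_neg (by omega), ha₀] at ht hh hcm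
    have hdm : m.arr 6 j = (d a₀).toNat + 1 := by rw [hI.2.1, ← ha₀, hd]
    have hck := hc a₀
    have hda := Bool.toNat_le (d a₀)
    have hkd : k * (d a₀).toNat ≤ k := by nlinarith
    have hvt := hvlt (tail a₀) (s a₀)
    have hvh := hvlt (head a₀) (t a₀)
    have hs1 := Bool.toNat_le (s a₀)
    have ht1 := Bool.toNat_le (t a₀)
    have hdiv1 : (2 * num (tail a₀) + (s a₀).toNat) / 2 = num (tail a₀) := by omega
    have hdiv2 : (2 * num (head a₀) + (t a₀).toNat) / 2 = num (head a₀) := by omega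
    have hrec : c a₀ + k * (d a₀).toNat = recolor c d k a₀ := by
      rw [recolor]; cases d a₀ <;> simp
    have hres : fuseArc.res m = ((m.setArr 2 j (recolor c d k a₀)).setArr 0 j
        (num (tail a₀))).setArr 1 j (num (head a₀)) := by
      simp [fuseArc, Prog.res, Expr.val, Op.apply, hm3, h4, ht, hh, hcm, hdm, hdiv1, hdiv2, hrec]
    rw [hres]
    refine ⟨?_, h2, h4, ?_, ?_, ?_⟩
    · simp [fuseArc, Prog.Fits, Prog.res, Expr.Fits, Expr.val, Op.apply, hm3, h4, ht, hh, hcm,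
        hdm, hdiv1, hdiv2]
      omega
    · intro i hi
      simp only [setVar_var, setArr_var]
      rw [if_neg (by omega)]; exact hI.1 i hi
    · rw [setVar_arr, setArr_arr_of_ne _ _ _ (by omega), setArr_arr_of_ne _ _ _ (by omega),
        setArr_arr_of_ne _ _ _ (by omega)]
      exact hI.2.1
    · intro a
      simp only [setVar_arr, setArr_arr, true_and, show ¬ (0 : ℕ) = 1 by omega,
        show ¬ (0 : ℕ) = 2 by omega, show ¬ (1 : ℕ) = 0 by omega, show ¬ (1 : ℕ) = 2 by omega,
        show ¬ (2 : ℕ) = 1 by omega, show ¬ (2 : ℕ) = 0 by omega, false_and, if_false]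
      by_cases haj : (e a).val = j
      · have : a = a₀ := e.injective (Fin.ext (haj.trans ha₀.symm))
        subst this
        simp [haj]
      · have hiff : (e a).val < j + 1 ↔ (e a).val < j := by omega
        simp only [if_neg haj, hiff]
        exact hI.2.2 a
  · refine ⟨fun i hi => ?_, rfl, fun a => ⟨?_, ?_, ?_⟩⟩
    · simp only [setVar_var]; rw [if_neg (by omega)]
    · rw [if_neg (by omega)]; exact h₀.tail a
    · rw [if_neg (by omega)]; exact h₀.head a
    · rw [if_neg (by omega)]; exact hcol a
  · intro m h2 hI
    exact hK m hI.1 (fun a => by rw [(hI.2.2 a).1, if_pos (e a).2])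
      (fun a => by rw [(hI.2.2 a).2.1, if_pos (e a).2])
      (fun a => by rw [(hI.2.2 a).2.2, if_pos (e a).2])

theorem law_mergeProg [Finite A] (hW : (M + 2) ^ 2 ≤ W) (hkM : k ≤ M) {num : V → ℕ}
    (hnum : Function.Injective num) {k₀ : ℕ} {tail head : A → V} {s t : A → Bool} {c : A → ℕ}
    (hc : Proper (fun a => (tail a, s a)) (fun a => (head a, t a)) c k)
    (hlt : ∀ v, 2 * num v + 1 < M) {m₀ : Mem}
    (h₀ : Holds e (splitNum num) (fun a => (tail a, s a)) (fun a => (head a, t a)) k₀ k m₀)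
    (hcol : ∀ a, m₀.arr 2 (e a) = c a) {T : ℕ} {μ : (A → Bool) → PMF X}
    (hK : ∀ d ∈ alternatingDivisions tail head c, ∀ m, Holds e num tail head k₀ (k * 2) m →
      (∀ a, m.arr 2 (e a) = recolor c d k a) → Law W T ⟨K, m⟩ f (μ d)) :
    Law W (T + (M * 34 + 17)) ⟨mergeProg :: K, m₀⟩ f
      ((uniformOn (alternatingDivisions tail head c)).bind μ) := by
  have hM2 : M * M + 4 * M + 4 ≤ W := by rw [sq] at hW; nlinarith
  obtain ⟨τ, hτ⟩ := exists_partner hc.mem hc.tail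
  obtain ⟨η, hη⟩ := exists_partner hc.mem hc.head
  refine Law.mono (law_seq (law_tabulate hW hkM hnum hc.mem hτ hη hlt h₀ hcol
    fun m₁ htab h6 hv₁ ha₁ => law_seq (law_walkProg hW hkM htab (partner_involutive hτ)
      (partner_involutive hη) (partner_ne hτ) (partner_ne hη) h6
      (Set.ext fun d => mem_alternatingDivisions hc hτ hη d)
      fun d hd m₂ hv₂ ha₂ h6₂ => law_seq (law_fuse (tail := tail) (head := head) (d := d) (k₀ := k₀) (s := s) (t := t) hW hkM
        (fun a => (Finset.mem_Icc.1 (hc.mem a)).2) hlt ?_ ?_ h6₂ fun m₃ hv₃ h0 h1 h2 =>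
        law_res (p := .assign 3 _) ?_ (hK d hd _ ?_ h2))))) ?_
  · exact ⟨by rw [hv₂ 1 (by omega), hv₁ 1 (by omega), h₀.var1],
      by rw [hv₂ 2 (by omega), hv₁ 2 (by omega), h₀.var2],
      by rw [hv₂ 3 (by omega), hv₁ 3 (by omega), h₀.var3],
      fun a => by rw [ha₂ 0 (by omega), ha₁ 0 (by omega)]; exact h₀.tail a,
      fun a => by rw [ha₂ 1 (by omega), ha₁ 1 (by omega)]; exact h₀.head a⟩
  · intro a; rw [ha₂ 2 (by omega), ha₁ 2 (by omega)]; exact hcol a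
  · have hv3 : m₃.var 3 = k := by
      rw [hv₃ 3 (by omega), hv₂ 3 (by omega), hv₁ 3 (by omega), h₀.var3]
    simp only [Prog.Fits, Expr.Fits, Expr.val, Op.apply, hv3]
    omega
  · have hv : ∀ i < 4, m₃.var i = m₀.var i := fun i hi => by
      rw [hv₃ i hi, hv₂ i hi, hv₁ i hi]
    exact ⟨by simpa [Prog.res] using (hv 1 (by omega)).trans h₀.var1,
      by simpa [Prog.res] using (hv 2 (by omega)).trans h₀.var2,
      by simp [Prog.res, Expr.val, Op.apply, (hv 3 (by omega)).trans h₀.var3], h0, h1⟩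
  · simp only [Prog.size]; omega

end MergeLaw

/-! ### The whole program -/

/-- Splits the vertices, level by level, until every vertex has one outgoing arc; variable `3`
holds the current degree. -/
def downLoop : Prog :=
  .while (.bin .lt (.lit 1) (.var 3)) <|
    .seq (.assign 3 (.bin .div (.var 3) (.lit 2))) <| .seq (splitProg 0) (splitProg 1)

/-- Gives every arc the color `1`. -/
def colorOne : Prog := forArcs (.store 2 (.var 4) (.lit 1))

/-- Recolors and fuses, level by level, up to the degree in variable `1`. -/
def upLoop : Prog := .while (.bin .lt (.var 3) (.var 1)) mergeProg

/-- The program: the recursion of the random procedure unrolled into one loop for the splits on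
the way down and one loop for the recolorings on the way up.  The vertex `v` is split into
`2 * v` and `2 * v + 1`, so that on the way up the ends of the arcs are recovered by halving. -/
def colorProg : Prog :=
  .seq (.assign 2 (.bin .mul (.var 0) (.var 1))) <| .seq (.assign 3 (.var 1)) <|
  .seq (.seq downLoop colorOne) upLoop

section ColorLaw

universe u

variable {A X : Type u} {M W k₀ : ℕ} {e : A ≃ Fin M} {K : List Prog} {f : Mem → X}

theorem law_colorOne {V : Type u} (hW : M + 2 ≤ W) {num : V → ℕ} {tail head : A → V} {k : ℕ}
    {m₀ : Mem} (h₀ : Holds e num tail head k₀ k m₀) {T : ℕ} {μ : PMF X}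
    (hK : ∀ m, Holds e num tail head k₀ k m → (∀ a, m.arr 2 (e a) = 1) → Law W T ⟨K, m⟩ f μ) :
    Law W (T + (M * 4 + 3)) ⟨colorOne :: K, m₀⟩ f μ := by
  let I : ℕ → Mem → Prop := fun j m => Holds e num tail head k₀ k m ∧
    ∀ a, (e a).val < j → m.arr 2 (e a) = 1
  refine law_forArcs hW I ?_ h₀.var2 ?_ fun m _ hI => hK m hI.1 fun a => hI.2 a (e a).2
  · intro j hj m h2 h4 hI
    refine ⟨?_, h2, h4, ⟨by simpa [Prog.res] using hI.1.var1, by simpa [Prog.res] using hI.1.var2,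
      by simpa [Prog.res] using hI.1.var3, fun a => by simpa [Prog.res] using hI.1.tail a,
      fun a => by simpa [Prog.res] using hI.1.head a⟩, fun a ha => ?_⟩
    · simp only [Prog.Fits, Expr.Fits]; omega
    · simp only [Prog.res, setVar_arr, setArr_arr, Expr.val, h4, true_and]
      split_ifs with h
      · rfl
      · exact hI.2 a (by omega)
  · exact ⟨⟨by simpa using h₀.var1, by simpa using h₀.var2, by simpa using h₀.var3, h₀.tail,
      h₀.head⟩, fun a ha => by omega⟩

/-- The two loops sample the random coloring: in the induction step, the first round of the loop on
the way down makes the splits, and the last round of the loop on the way up, which is part of what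
follows for the induction hypothesis, makes the recoloring. -/
theorem law_levels [Finite A] (hW : (M + 2) ^ 2 ≤ W) (hW' : 4 * (M + 2) ≤ W) (hM : 0 < M)
    (hk₀ : k₀ ≤ M) (l : ℕ) {V : Type u} [Finite V] {num : V → ℕ}
    (hnum : Function.Injective num) {N : ℕ} (hN : ∀ v, num v < N) (hNM : N * 2 ^ l = M)
    {tail head : A → V} (ht : RegularMap tail (2 ^ l)) (hh : RegularMap head (2 ^ l))
    (hl : 2 ^ l ≤ k₀) {m₀ : Mem} (h₀ : Holds e num tail head k₀ (2 ^ l) m₀) {T : ℕ}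
    {μ : (A → ℕ) → PMF X}
    (hK : ∀ c, Proper tail head c (2 ^ l) → ∀ m, Holds e num tail head k₀ (2 ^ l) m →
      (∀ a, m.arr 2 (e a) = c a) → Law W T ⟨upLoop :: K, m⟩ f (μ c)) :
    Law W (T + (M * 120 * l + M * 4 + 4)) ⟨downLoop :: colorOne :: upLoop :: K, m₀⟩ f
      ((randColoringAux l tail head).bind μ) := by
  induction l generalizing V N m₀ T μ with
  | zero =>
    rw [randColoringAux, PMF.pure_bind]
    refine Law.mono (law_while_false ?_ ?_ (law_colorOne (by omega) h₀ fun m hm h2 =>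
      hK _ (proper_one ht hh) m hm h2)) (by omega)
    · simp only [Expr.Fits, Expr.val, Op.apply, h₀.var3, pow_zero, lt_irrefl, if_false]; omega
    · simp [Expr.val, Op.apply, h₀.var3]
  | succ l ih =>
    have hk : 0 < 2 ^ l := by positivity
    have hpow : 2 ^ (l + 1) = 2 * 2 ^ l := pow_succ' 2 l
    have hkM : 2 ^ l ≤ M := by omega
    have hNM' : (2 * N) * 2 ^ l = M := by rw [← hNM, hpow]; ring
    have h2N : 2 * N ≤ M := by rw [← hNM']; exact Nat.le_mul_of_pos_right _ hk
    have hlt : ∀ v, 2 * num v + 1 < M := fun v => by have := hN v; omega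
    have h3 := h₀.var3
    rw [hpow] at ht hh h3
    simp only [randColoringAux_succ, PMF.bind_bind, PMF.pure_bind]
    set m₁ := (Prog.assign 3 (.bin .div (.var 3) (.lit 2))).res m₀ with hm₁
    have hdiv : 2 * 2 ^ l / 2 = 2 ^ l := by omega
    have hv₁ : m₁.var 1 = k₀ ∧ m₁.var 2 = M ∧ m₁.var 3 = 2 ^ l := by
      simp [hm₁, Prog.res, Expr.val, Op.apply, h3, h₀.var1, h₀.var2]
    have ha₁ : m₁.arr = m₀.arr := rfl
    refine Law.mono (T := T + (M * 34 + 18) + (M * 120 * l + M * 4 + 4) + (M * 17 + 8) +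
      (M * 17 + 8) + 1 + 1 + 1 + 1) (law_while_true ?_ ?_ (law_seq (law_res (p := .assign 3 _) ?_
      (law_seq (law_splitProg (e := e) (m₀ := m₁) (by omega) hnum hN h2N hkM hW' ht hv₁.2.1 hv₁.2.2
      (fun a => ?_) fun s hs m₂ hv₂ ha₂ hs₂ => law_splitProg (e := e) (by omega) hnum hN h2N hkM hW' hh
      ?_ ?_ (fun a => ?_) fun t ht' m₃ hv₃ ha₃ ht₃ => ?_))))) ?_
    · simp only [Expr.Fits, Expr.val, Op.apply, h3, if_pos (show 1 < 2 * 2 ^ l by omega)]; omega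
    · simp [Expr.val, Op.apply, h3]; omega
    · simp only [Prog.Fits, Expr.Fits, Expr.val, Op.apply, h3]; omega
    · rw [ha₁]; exact h₀.tail a
    · rw [hv₂ 2 (by omega)]; exact hv₁.2.1
    · rw [hv₂ 3 (by omega)]; exact hv₁.2.2
    · rw [ha₂ 1 (by omega) (by omega), ha₁]; exact h₀.head a
    · refine ih (num := splitNum num) (splitNum_injective hnum) (N := 2 * N) ?_ hNM'
        (regularMap_split ht hs) (regularMap_split hh ht') (by omega) ?_ ?_
      · rintro ⟨v, b⟩
        have := hN v
        have := Bool.toNat_le b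
        simp only [splitNum]; omega
      · refine ⟨?_, ?_, ?_, fun a => ?_, fun a => ht₃ a⟩
        · rw [hv₃ 1 (by omega), hv₂ 1 (by omega)]; exact hv₁.1
        · rw [hv₃ 2 (by omega), hv₂ 2 (by omega)]; exact hv₁.2.1
        · rw [hv₃ 3 (by omega), hv₂ 3 (by omega)]; exact hv₁.2.2
        · rw [ha₃ 0 (by omega) (by omega)]; exact hs₂ a
      · intro c hc m hm h2
        refine law_while_true ?_ ?_ (law_mergeProg hW hkM hnum hc hlt hm h2
          fun d hd m' hm' h2' => ?_)
        · simp only [Expr.Fits, Expr.val, Op.apply, hm.var3, hm.var1,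
            if_pos (show 2 ^ l < k₀ by omega)]
          omega
        · simp [Expr.val, Op.apply, hm.var3, hm.var1]; omega
        · rw [mul_comm, ← hpow] at hm'
          refine hK _ ?_ m' hm' h2'
          rw [hpow]; exact proper_recolor hc hd
    · rw [mul_add_one]; omega

end ColorLaw

/-- The polynomial bounds on words and time that the program needs: the products of a vertex number
and a number of colors are at most `M ^ 2`, and each of the `l` levels takes at most `120 * M`
steps. -/
theorem samplesWithin_of_le {V : Type*} [Finite V] {G : Digraph V} {n k l M W T : ℕ}
    (hn : 0 < n) (hk : k = 2 ^ l) (hG : IsRegular G k) (hM : n * k = M)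
    (hW : (M + 2) ^ 2 ≤ W) (hW' : 4 * (M + 2) ≤ W) (hT : M * 120 * l + M * 4 + 11 ≤ T) :
    SamplesWithin G n M k colorProg W T (randCycleCoverColoring G l) := by
  intro vertexNo arcs
  have hk0 : 0 < k := by rw [hk]; positivity
  have hM0 : 0 < M := hM ▸ Nat.mul_pos hn hk0
  have hnM : n ≤ M := hM ▸ Nat.le_mul_of_pos_right n hk0
  have hkM : k ≤ M := hM ▸ Nat.le_mul_of_pos_left k hn
  have ht := regularMap_tail hG
  have hh := regularMap_head hG
  set m₀ := inputMem k vertexNo arcs with hm₀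
  have h0 : m₀.var 0 = n := rfl
  have h1 : m₀.var 1 = k := rfl
  have harr : ∀ a : Arc G, m₀.arr 0 (arcs.symm a) = vertexNo a.tail ∧
      m₀.arr 1 (arcs.symm a) = vertexNo a.head := by
    intro a; simp [hm₀, inputMem]
  have hres : (Prog.assign 2 (.bin .mul (.var 0) (.var 1))).res m₀ = m₀.setVar 2 M := by
    simp [Prog.res, Expr.val, Op.apply, h0, h1, hM]
  have hres' : (Prog.assign 3 (.var 1)).res (m₀.setVar 2 M) = (m₀.setVar 2 M).setVar 3 k := by
    simp [Prog.res, Expr.val, h1]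
  have hlaw : Law W (1 + 1 + (M * 120 * l + M * 4 + 4) + 1 + 1 + 1 + 1 + 1) ⟨[colorProg], m₀⟩
      (fun mem (a : Arc G) => mem.arr 2 (arcs.symm a).val)
      ((randColoringAux l (Arc.tail : Arc G → V) Arc.head).bind PMF.pure) := by
    refine Law.mono (law_seq (law_res (p := .assign 2 _) ?_ (law_seq (law_res (p := .assign 3 _) ?_
      (law_seq (T := 1 + (M * 120 * l + M * 4 + 4) + 1) (law_seq ?_)))))) ?_
    · simp only [Prog.Fits, Expr.Fits, Expr.val, Op.apply, h0, h1, hM]; omega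
    · rw [hres]
      simp only [Prog.Fits, Expr.Fits, setVar_var, h1]
      rw [if_neg (by omega)]; omega
    · rw [hres, hres']
      subst hk
      refine law_levels (e := arcs.symm) (k₀ := 2 ^ l) hW hW' hM0 hkM l
        (num := fun v => (vertexNo v).val) (fun v w h => vertexNo.injective (Fin.ext h))
        (fun v => (vertexNo v).2) hM ht hh le_rfl ?_ ?_
      · exact ⟨by simp [h1], by simp, by simp, fun a => (harr a).1, fun a => (harr a).2⟩
      · intro c _ m hm h2
        have hc : c = fun a : Arc G => m.arr 2 (arcs.symm a).val := funext fun a => (h2 a).symm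
        rw [hc]
        refine law_while_false (T := 0) ?_ ?_
          (law_halted (f := fun mem (a : Arc G) => mem.arr 2 (arcs.symm a).val))
        · simp only [Expr.Fits, Expr.val, Op.apply, hm.var3, hm.var1, lt_irrefl, if_false]; omega
        · simp [Expr.val, Op.apply, hm.var3, hm.var1]
    · simp only [Prog.size]; omega
  rw [PMF.bind_pure] at hlaw
  exact hlaw.mono (by omega)

theorem samplesWithin_colorProg {V : Type*} [Finite V] {G : Digraph V} {n k l : ℕ}
    (hn : 0 < n) (hk : k = 2 ^ l) (hG : IsRegular G k) :
    SamplesWithin G n (n * k) k colorProg ((n * k + 2) ^ 200) (200 * (n * k * max 1 l))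
      (randCycleCoverColoring G l) := by
  have hM0 : 0 < n * k := Nat.mul_pos hn (by rw [hk]; positivity)
  refine samplesWithin_of_le hn hk hG rfl (Nat.pow_le_pow_right (by omega) (by omega)) ?_ ?_
  · have h1 : (n * k + 2) ^ 3 ≤ (n * k + 2) ^ 200 := Nat.pow_le_pow_right (by omega) (by omega)
    have h2 : 4 * (n * k + 2) ≤ (n * k + 2) ^ 3 := by
      have : 2 * 2 ≤ (n * k + 2) * (n * k + 2) := Nat.mul_le_mul (by omega) (by omega)
      calc 4 * (n * k + 2) ≤ (n * k + 2) * (n * k + 2) * (n * k + 2) :=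
            Nat.mul_le_mul_right _ this
        _ = (n * k + 2) ^ 3 := by ring
    exact h2.trans h1
  · generalize n * k = M at hM0 ⊢
    have h2 : M ≤ M * max 1 l := Nat.le_mul_of_pos_right _ (by omega)
    have h3 : M * l ≤ M * max 1 l := Nat.mul_le_mul_left _ (by omega)
    have h4 : M * 120 * l = 120 * (M * l) := by ring
    omega

end CycleCovers

theorem mainTheorem2 :
    ∃ (c D : ℝ) (P : CycleCovers.Prog) (C : ℕ), 0 < c ∧
      ∀ (V : Type*) [Fintype V] [Nonempty V] (G : Digraph V) (n k l : ℕ),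
        Fintype.card V = n → k = 2 ^ l → (∀ v, ¬ G.Adj v v) → CycleCovers.IsRegular G k →
        -- every possible output is a cycle cover coloring
        (∀ col ∈ (CycleCovers.randCycleCoverColoring G l).support,
          CycleCovers.IsCycleCoverColoring G k col) ∧
        -- except with probability exponentially small in `n`, some color class has at most
        -- `3.5 n / ln k` components (written so that it is void for `k = 1`)
        (CycleCovers.randCycleCoverColoring G l).toOuterMeasure
            {col | ¬ ∃ i ∈ Finset.Icc 1 k,
              (CycleCovers.numComponents G (col ⁻¹' {i}) : ℝ) * Real.log k ≤ 3.5 * n} ≤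
          ENNReal.ofReal (D * Real.exp (-c * n)) ∧
        -- the procedure runs in time `O(n k log k)` on a word RAM with words of `O(log (n k))` bits
        CycleCovers.SamplesWithin G n (n * k) k P ((n * k + 2) ^ C) (C * (n * k * max 1 l))
          (CycleCovers.randCycleCoverColoring G l) ∧
        -- the probability of each fixed cycle cover coloring
        (∀ col, CycleCovers.IsCycleCoverColoring G k col →
          (CycleCovers.randCycleCoverColoring G l col).toReal ≤
            ((k : ℝ) ^ k / (k.factorial : ℝ) ^ 2) ^ n / 2 ^ (k - 1)) ∧
        -- the number of cycle covers with `r` cycles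
        (∀ r : ℕ, {F : Set (CycleCovers.Arc G) |
            CycleCovers.IsCycleCover G F ∧ CycleCovers.numComponents G F = r}.ncard ≤
          n.choose r * k ^ (n - r)) := by
  refine ⟨1 / 2, 1, CycleCovers.colorProg, 200, by norm_num, ?_⟩
  rintro V _ _ G n k l rfl rfl - hG
  have ht := CycleCovers.regularMap_tail hG
  have hh := CycleCovers.regularMap_head hG
  have hb := CycleCovers.randColoringAux_apply_le l ht hh
  have hp : ∀ col ∈ (CycleCovers.randCycleCoverColoring G l).support,
      CycleCovers.IsCycleCoverColoring G (2 ^ l) col := fun col hcol =>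
    (CycleCovers.proper_of_mem_support l ht hh hcol).isCycleCoverColoring
  refine ⟨hp, ?_, CycleCovers.samplesWithin_colorProg Fintype.card_pos rfl hG, fun col _ => ?_,
    CycleCovers.ncard_cycleCovers_le hG⟩
  · rw [one_mul]
    exact CycleCovers.toOuterMeasure_bad_le hG (by positivity) _ hp hb
  · exact ENNReal.toReal_le_of_le_ofReal (CycleCovers.colorBound_nonneg _ _) (hb col)
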